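/- Let $G=\{G(x),x\in\mathbb{R}\}$ be a real-valued Gaussian process with mean zero, stationary increments and almost surely continuous sample paths, and let $\sigma(h)\ge 0$ be defined by $\sigma^2(h)=E(G(x+h)-G(x))^2$ for $h\in\mathbb{R}$ (which does not depend on $x$). Assume that, for some $\delta>0$, $\sigma^2$ is concave and monotonically increasing (in the wide sense) on $[0,\delta]$ and is not identically zero there. Let $1\le p<\infty$, let $q>p$, and set $h_n=1/(\log n)^q$ for $n\ge 2$. If $$\lim_{n\to\infty}\frac{\sigma(h_n-h_{n+1})}{\sigma(h_{n+1})}=0,$$ then, almost surely, $$\lim_{h\to 0}\int_a^b\left|\frac{G(x+h)-G(x)}{\sigma(h)}\right|^p dx=E|\eta|^p\,(b-a)\qquad\text{for all } a,b\in\mathbb{R},$$ where $\eta$ is a normal random variable with mean zero and variance one, the limit is over $h\ne 0$ of either sign, and $\int_a^b=-\int_b^a$ when $a>b$. -/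

import Mathlib

open MeasureTheory ProbabilityTheory Filter Topology Set

/-- A real-valued process indexed by `ℝ` has stationary increments: for every shift `t`, the
process `x ↦ G (x + t) - G t` has the same finite-dimensional distributions as
`x ↦ G x - G 0`. -/
def HasStationaryIncrements {Ω : Type*} [MeasurableSpace Ω] (G : ℝ → Ω → ℝ)
    (P : Measure Ω) : Prop :=
  ∀ (t : ℝ) (I : Finset ℝ),
    IdentDistrib (fun ω ↦ I.restrict fun x ↦ G (x + t) ω - G t ω)
      (fun ω ↦ I.restrict fun x ↦ G x ω - G 0 ω) P P

/-- The increment variance `σ²(h) = E (G(h) - G(0))²`; for a process with stationary increments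
this equals `E (G(x + h) - G(x))²` for every `x` (see `incrementVar_eq`). -/
noncomputable def incrementVar {Ω : Type*} [MeasurableSpace Ω] (G : ℝ → Ω → ℝ)
    (P : Measure Ω) (h : ℝ) : ℝ :=
  ∫ ω, (G h ω - G 0 ω) ^ 2 ∂P

/-- The increment standard deviation `σ(h)`, the nonnegative square root of `σ²(h)`. -/
noncomputable def incrementStd {Ω : Type*} [MeasurableSpace Ω] (G : ℝ → Ω → ℝ)
    (P : Measure Ω) (h : ℝ) : ℝ :=
  √(incrementVar G P h)

theorem incrementVar_eq {Ω : Type*} [MeasurableSpace Ω] {G : ℝ → Ω → ℝ} {P : Measure Ω}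
    (hG : HasStationaryIncrements G P) (x h : ℝ) :
    ∫ ω, (G (x + h) ω - G x ω) ^ 2 ∂P = incrementVar G P h := by
  have h1 := (hG x {h}).comp
    (u := fun v : (({h} : Finset ℝ) → ℝ) ↦ (v ⟨h, Finset.mem_singleton_self h⟩) ^ 2)
    (by fun_prop)
  have h2 := h1.integral_eq
  simpa [Function.comp_def, incrementVar, add_comm x h] using h2

/-- The `L^p` increment integral `I_G(h; a, b, p) = ∫_a^b |(G(x + h) - G(x)) / σ(h)|^p dx` along
the path `ω`, as an oriented integral. -/
noncomputable def lpIncrement {Ω : Type*} [MeasurableSpace Ω] (G : ℝ → Ω → ℝ)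
    (P : Measure Ω) (p a b h : ℝ) (ω : Ω) : ℝ :=
  ∫ x in a..b, |(G (x + h) ω - G x ω) / incrementStd G P h| ^ p

/-! ### Maurey–Pisier concentration for smooth functions of a Gaussian vector -/

section GaussianConcentration

variable {E : Type*} [NormedAddCommGroup E] [NormedSpace ℝ E]

/-! At a fixed scale `h` the normalised `L^p` norm of the increments concentrates so sharply that
Borel–Cantelli applies along `h_n`; the condition on `σ` then controls the scales between `h_{n+1}`
and `h_n`.

Concentration. Sampled on a grid of an interval of length `L`, the increments divided by `σ(h)` form
a centered Gaussian vector with unit variances, and the `p`-th power of its averaged `ℓ^p` norm `F`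
has mean exactly `E|η|^p`. By Maurey–Pisier (`lintegral_exp_sub_le_of_isGaussian`) the oscillation
of `F` is sub-Gaussian, governed by the largest variance of its differentials. These lie in the dual
unit ball of weighted `ℓ^p`, so a Schur argument (`sum_sum_mul_le_rpow`) bounds that variance by
`r^{1/p}`, where `r` bounds the averaged absolute correlations along each row. The correlations are
second differences of `σ²` over `2σ²(h)`. By concavity their sums telescope
(`sum_range_abs_second_difference_le`), so `r = 6h/L` whatever the mesh. Refining the mesh gives
`measureReal_lpIncrement_deviation_le`: up to a bias of order `(h/L)^{1/(2p)}`, the deviation from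
`(E|η|^p)^{1/p}` exceeds `τ` with probability at most `2 exp(-cτ²(L/h)^{1/p})`. At `h = h_n` this is
`2 exp(-c'(log n)^{q/p})`, summable because `q > p`.

Interpolation, path by path. For `u` between `h_{n+1}` and `h_n`, Minkowski splits the increment
over `u` into one over `h_{n+1}` and a remainder over `u - h_{n+1} ≤ h_n - h_{n+1}`. Iterating such
splittings down the scales bounds the remainder by a constant times `σ(h_n - h_{n+1})`
(`incrementNorm_le_of_seq`), which is negligible against `σ(h_{n+1})`. Subadditivity of `σ²` makes
`σ(u)` and `σ(h_{n+1})` asymptotically equal, so the limit along `h_n` is the limit as `u → 0+`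
(`tendsto_incrementNorm_div`).

A single null set serves all rational endpoints. Monotonicity of the integral in its endpoint
extends the limit to real, even moving, endpoints, and a translation then handles negative `h`. -/

/-- Jensen's inequality for the exponential along the quarter circle joining two points. -/
theorem exp_sub_le_integral_rotation {F : E → ℝ} {F' : E → E →L[ℝ] ℝ}
    (hF : ∀ x, HasFDerivAt F (F' x) x) (hF' : Continuous F') (t : ℝ) (z : E × E) :
    Real.exp (t * (F z.2 - F z.1)) ≤ (2 / Real.pi) * ∫ θ in Ioc 0 (Real.pi / 2),
      Real.exp (t * (Real.pi / 2) * F' (ContinuousLinearMap.rotation θ z).1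
        (ContinuousLinearMap.rotation θ z).2) := by
  have hpi := Real.pi_pos
  have hc : Continuous fun θ : ℝ ↦ F' (ContinuousLinearMap.rotation θ z).1
      (ContinuousLinearMap.rotation θ z).2 := by
    simp only [ContinuousLinearMap.rotation_apply]
    fun_prop
  have hd : ∀ θ : ℝ, HasDerivAt (fun θ ↦ F (ContinuousLinearMap.rotation θ z).1)
      (F' (ContinuousLinearMap.rotation θ z).1 (ContinuousLinearMap.rotation θ z).2) θ := by
    intro θ
    have h1 : HasDerivAt (fun θ : ℝ ↦ (ContinuousLinearMap.rotation θ z).1)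
        ((ContinuousLinearMap.rotation θ z).2) θ := by
      simp only [ContinuousLinearMap.rotation_apply]
      exact ((Real.hasDerivAt_cos θ).smul_const z.1).add ((Real.hasDerivAt_sin θ).smul_const z.2)
    exact (hF _).comp_hasDerivAt θ h1
  have hftc : ∫ θ in (0 : ℝ)..(Real.pi / 2), F' (ContinuousLinearMap.rotation θ z).1
      (ContinuousLinearMap.rotation θ z).2 = F z.2 - F z.1 := by
    rw [intervalIntegral.integral_eq_sub_of_hasDerivAt (fun θ _ ↦ hd θ)
      (hc.intervalIntegrable _ _)]
    simp [ContinuousLinearMap.rotation_apply]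
  have hJ := convexOn_exp.map_set_average_le (μ := volume) (t := Ioc (0 : ℝ) (Real.pi / 2))
    (f := fun θ ↦ t * (Real.pi / 2) * F' (ContinuousLinearMap.rotation θ z).1
      (ContinuousLinearMap.rotation θ z).2) Real.continuous_exp.continuousOn isClosed_univ
    (by simp [hpi]) (by simp) (by simp)
    ((continuous_const.mul hc).integrableOn_Ioc)
    ((Real.continuous_exp.comp (continuous_const.mul hc)).integrableOn_Ioc)
  rw [setAverage_eq, setAverage_eq, integral_const_mul,
    ← intervalIntegral.integral_of_le (by positivity), hftc] at hJ
  have hv : (volume : Measure ℝ).real (Ioc (0 : ℝ) (Real.pi / 2)) = Real.pi / 2 := by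
    simp [Measure.real]
    positivity
  rw [hv] at hJ
  simp only [smul_eq_mul, inv_div] at hJ
  convert hJ using 2
  field_simp

variable [CompleteSpace E] [SecondCountableTopology E] [MeasurableSpace E] [BorelSpace E]

theorem lintegral_exp_dual_eq (μ : Measure E) [IsGaussian μ] (hμ : μ[id] = 0)
    (L : StrongDual ℝ E) (t : ℝ) :
    ∫⁻ x, ENNReal.ofReal (Real.exp (t * L x)) ∂μ
      = ENNReal.ofReal (Real.exp (t ^ 2 / 2 * Var[L; μ])) := by
  have hmap := IsGaussian.map_eq_gaussianReal (μ := μ) L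
  have h0 : ∫ x, L x ∂μ = 0 := by
    have := IsGaussian.integral_dual (μ := μ) L
    simp only [id_eq] at hμ
    simp [this, hμ]
  rw [h0] at hmap
  have hm := mgf_gaussianReal hmap t
  have hint : Integrable (fun x ↦ Real.exp (t * L x)) μ := by
    rw [← mgf_pos_iff (X := L) (t := t), hm]
    positivity
  rw [← ofReal_integral_eq_lintegral_ofReal hint (ae_of_all _ fun x ↦ (Real.exp_pos _).le)]
  change ENNReal.ofReal (mgf L μ t) = _
  rw [hm, Real.coe_toNNReal _ (variance_nonneg _ _)]
  congr 2
  ring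

/-- The Maurey–Pisier inequality: a smooth function of a centered Gaussian vector has
sub-Gaussian oscillation, controlled by the variance of its differentials. -/
theorem lintegral_exp_sub_le_of_isGaussian (μ : Measure E) [IsGaussian μ] (hμ : μ[id] = 0)
    {F : E → ℝ} {F' : E → E →L[ℝ] ℝ} (hF : ∀ x, HasFDerivAt F (F' x) x) (hF' : Continuous F')
    {s : ℝ} (hs : ∀ x, Var[F' x; μ] ≤ s) (t : ℝ) :
    ∫⁻ z, ENNReal.ofReal (Real.exp (t * (F z.2 - F z.1))) ∂(μ.prod μ)
      ≤ ENNReal.ofReal (Real.exp (t ^ 2 * (Real.pi ^ 2 / 8) * s)) := by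
  have hpi := Real.pi_pos
  set H : ℝ → E × E → ENNReal := fun θ z ↦ ENNReal.ofReal (Real.exp (t * (Real.pi / 2) *
    F' (ContinuousLinearMap.rotation θ z).1 (ContinuousLinearMap.rotation θ z).2)) with hH
  have hcont : Continuous fun p : (E × E) × ℝ ↦ Real.exp (t * (Real.pi / 2) *
      F' (ContinuousLinearMap.rotation p.2 p.1).1 (ContinuousLinearMap.rotation p.2 p.1).2) := by
    simp only [ContinuousLinearMap.rotation_apply]
    fun_prop
  have hHθ : ∀ θ, ∫⁻ z, H θ z ∂(μ.prod μ)
      ≤ ENNReal.ofReal (Real.exp (t ^ 2 * (Real.pi ^ 2 / 8) * s)) := by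
    intro θ
    have hc : Continuous fun z : E × E ↦ Real.exp (t * (Real.pi / 2) * F' z.1 z.2) := by fun_prop
    have h1 : ∫⁻ z, H θ z ∂(μ.prod μ)
        = ∫⁻ z, ENNReal.ofReal (Real.exp (t * (Real.pi / 2) * F' z.1 z.2)) ∂(μ.prod μ) := by
      -- Rotation invariance of the centered product law removes `θ`: each point of the quarter
      -- circle contributes the same integral.
      conv_rhs => rw [← IsGaussian.map_rotation_eq_self (μ := μ) hμ θ]
      rw [lintegral_map hc.measurable.ennreal_ofReal
        (ContinuousLinearMap.rotation θ).continuous.measurable]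
    rw [h1, lintegral_prod _ hc.measurable.ennreal_ofReal.aemeasurable]
    -- With the first coordinate frozen, its differential is linear in the second, hence a centered
    -- Gaussian with explicit exponential moment.
    calc _ ≤ ∫⁻ _, ENNReal.ofReal (Real.exp (t ^ 2 * (Real.pi ^ 2 / 8) * s)) ∂μ := by
          refine lintegral_mono fun x ↦ ?_
          rw [lintegral_exp_dual_eq μ hμ (F' x)]
          refine ENNReal.ofReal_le_ofReal (Real.exp_le_exp.2 ?_)
          calc _ = t ^ 2 * (Real.pi ^ 2 / 8) * Var[F' x; μ] := by ring
            _ ≤ _ := mul_le_mul_of_nonneg_left (hs x) (by positivity)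
      _ = _ := by simp
  calc _ ≤ ∫⁻ z, (ENNReal.ofReal (2 / Real.pi) *
          ∫⁻ θ in Ioc 0 (Real.pi / 2), H θ z) ∂(μ.prod μ) := by
        refine lintegral_mono fun z ↦ ?_
        have hz : Continuous fun θ : ℝ ↦ Real.exp (t * (Real.pi / 2) *
            F' (ContinuousLinearMap.rotation θ z).1 (ContinuousLinearMap.rotation θ z).2) := by
          simp only [ContinuousLinearMap.rotation_apply]
          fun_prop
        have hzi : Integrable (fun θ : ℝ ↦ Real.exp (t * (Real.pi / 2) *
            F' (ContinuousLinearMap.rotation θ z).1 (ContinuousLinearMap.rotation θ z).2))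
            (volume.restrict (Ioc 0 (Real.pi / 2))) := hz.integrableOn_Ioc
        have h2 := ofReal_integral_eq_lintegral_ofReal hzi
          (ae_of_all _ fun θ ↦ (Real.exp_pos _).le)
        have h3 := ENNReal.ofReal_le_ofReal (exp_sub_le_integral_rotation hF hF' t z)
        rw [ENNReal.ofReal_mul (by positivity), h2] at h3
        exact h3
    _ = ENNReal.ofReal (2 / Real.pi) *
          ∫⁻ θ in Ioc 0 (Real.pi / 2), ∫⁻ z, H θ z ∂(μ.prod μ) := by
        rw [lintegral_const_mul' _ _ ENNReal.ofReal_ne_top, lintegral_lintegral_swap]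
        exact hcont.measurable.ennreal_ofReal.aemeasurable
    _ ≤ ENNReal.ofReal (2 / Real.pi) * ∫⁻ _ in Ioc 0 (Real.pi / 2),
          ENNReal.ofReal (Real.exp (t ^ 2 * (Real.pi ^ 2 / 8) * s)) := by
        gcongr with θ
        exact hHθ θ
    _ = _ := by
        rw [setLIntegral_const, Real.volume_Ioc, sub_zero, mul_comm (ENNReal.ofReal (Real.exp _)),
          ← mul_assoc, ← ENNReal.ofReal_mul (by positivity)]
        rw [show 2 / Real.pi * (Real.pi / 2) = 1 by field_simp]
        simp

end GaussianConcentration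

/-! ### The weighted `ℓ^p` norm: smoothing, gradient and variance bound -/

section WeightedNorm

variable {ι : Type*} [Fintype ι]

/-- The smoothed weighted power sum `∑ wᵢ (xᵢ² + ε) ^ (p / 2)`; for `ε = 0` it is
`∑ wᵢ |xᵢ| ^ p`. -/
noncomputable def smoothPowSum (w : ι → ℝ) (p ε : ℝ) (x : ι → ℝ) : ℝ :=
  ∑ i, w i * (x i ^ 2 + ε) ^ (p / 2)

/-- The smoothed weighted `ℓ^p` norm; for `ε = 0` it is the weighted `ℓ^p` norm. -/
noncomputable def smoothLpNorm (w : ι → ℝ) (p ε : ℝ) (x : ι → ℝ) : ℝ :=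
  smoothPowSum w p ε x ^ p⁻¹

theorem smoothPowSum_zero (w : ι → ℝ) (p : ℝ) (x : ι → ℝ) :
    smoothPowSum w p 0 x = ∑ i, w i * |x i| ^ p := by
  unfold smoothPowSum
  refine Finset.sum_congr rfl fun i _ ↦ ?_
  rw [add_zero, ← sq_abs, ← Real.rpow_natCast, ← Real.rpow_mul (abs_nonneg _)]
  congr 2
  push_cast
  ring

theorem smoothPowSum_nonneg {w : ι → ℝ} (hw : ∀ i, 0 ≤ w i) (p : ℝ) {ε : ℝ} (hε : 0 ≤ ε)
    (x : ι → ℝ) : 0 ≤ smoothPowSum w p ε x :=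
  Finset.sum_nonneg fun i _ ↦ mul_nonneg (hw i) (by positivity)

theorem smoothPowSum_pos {w : ι → ℝ} (hw : ∀ i, 0 ≤ w i) (hw1 : ∑ i, w i = 1) {p ε : ℝ}
    (hε : 0 < ε) (x : ι → ℝ) : 0 < smoothPowSum w p ε x := by
  obtain ⟨i, hi, hwi⟩ : ∃ i ∈ Finset.univ, 0 < w i := by
    apply Finset.exists_lt_of_sum_lt
    simp [hw1]
  refine lt_of_lt_of_le ?_ (Finset.single_le_sum
    (f := fun i ↦ w i * (x i ^ 2 + ε) ^ (p / 2))
    (fun j _ ↦ mul_nonneg (hw j) (by positivity)) hi)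
  positivity

theorem continuous_smoothLpNorm (w : ι → ℝ) {p : ℝ} (hp : 0 < p) :
    Continuous fun z : ℝ × (ι → ℝ) ↦ smoothLpNorm w p z.1 z.2 := by
  unfold smoothLpNorm smoothPowSum
  refine Continuous.rpow_const (continuous_finsetSum _ fun i _ ↦ ?_)
    fun _ ↦ Or.inr (by positivity)
  exact continuous_const.mul
    (Continuous.rpow_const (by fun_prop) fun _ ↦ Or.inr (by positivity))

/-- The partial derivatives of `smoothLpNorm`. -/
noncomputable def smoothLpNormCoeff (w : ι → ℝ) (p ε : ℝ) (x : ι → ℝ) (i : ι) : ℝ :=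
  smoothPowSum w p ε x ^ (p⁻¹ - 1) * (w i * ((x i ^ 2 + ε) ^ (p / 2 - 1) * x i))

theorem hasFDerivAt_smoothLpNorm {w : ι → ℝ} (hw : ∀ i, 0 ≤ w i) (hw1 : ∑ i, w i = 1)
    {p ε : ℝ} (hp : 0 < p) (hε : 0 < ε) (x : ι → ℝ) :
    HasFDerivAt (smoothLpNorm w p ε)
      (∑ i, smoothLpNormCoeff w p ε x i • ContinuousLinearMap.proj (R := ℝ) (φ := fun _ : ι ↦ ℝ) i)
      x := by
  have h1 : ∀ i, HasFDerivAt (fun x : ι → ℝ ↦ w i * (x i ^ 2 + ε) ^ (p / 2))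
      ((w i * (p * ((x i ^ 2 + ε) ^ (p / 2 - 1) * x i))) •
        ContinuousLinearMap.proj (R := ℝ) (φ := fun _ : ι ↦ ℝ) i) x := by
    intro i
    have h2 : HasFDerivAt (fun x : ι → ℝ ↦ x i)
        (ContinuousLinearMap.proj (R := ℝ) (φ := fun _ : ι ↦ ℝ) i) x := hasFDerivAt_apply i x
    have h3 := (((h2.pow 2).add_const ε).rpow_const (p := p / 2)
      (Or.inl (by positivity))).const_mul (w i)
    refine h3.congr_fderiv ?_
    ext v
    simp
    ring
  have h4 := (HasFDerivAt.fun_sum (u := Finset.univ) fun i _ ↦ h1 i).rpow_const (p := p⁻¹)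
    (Or.inl (smoothPowSum_pos hw hw1 hε x).ne')
  refine h4.congr_fderiv ?_
  rw [Finset.smul_sum]
  refine Finset.sum_congr rfl fun i _ ↦ ?_
  rw [smul_smul]
  congr 1
  simp only [smoothLpNormCoeff, smoothPowSum]
  field_simp

theorem continuous_smoothLpNormCoeff {w : ι → ℝ} (hw : ∀ i, 0 ≤ w i) (hw1 : ∑ i, w i = 1)
    {p ε : ℝ} (hε : 0 < ε) (i : ι) : Continuous fun x ↦ smoothLpNormCoeff w p ε x i := by
  have h1 : ∀ (i : ι) (q : ℝ), Continuous fun x : ι → ℝ ↦ (x i ^ 2 + ε) ^ q := fun i q ↦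
    Continuous.rpow_const (by fun_prop) fun _ ↦ Or.inl (by positivity)
  unfold smoothLpNormCoeff
  refine Continuous.mul (Continuous.rpow_const ?_
    fun x ↦ Or.inl (smoothPowSum_pos hw hw1 hε x).ne') ?_
  · unfold smoothPowSum
    exact continuous_finsetSum _ fun i _ ↦ continuous_const.mul (h1 _ _)
  · exact continuous_const.mul ((h1 _ _).mul (continuous_apply i))

/-- A Schur-type bound for a quadratic form over the unit ball of the dual of a weighted
`ℓ^p` space. -/
theorem sum_sum_mul_le_rpow {w v : ι → ℝ} {R : ι → ι → ℝ} {p r : ℝ} (hp : 1 ≤ p)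
    (hw : ∀ i, 0 ≤ w i) (hw1 : ∑ i, w i = 1) (hv : ∀ i, 0 < v i)
    (hwv : ∑ i, w i * v i ^ p = 1) (hR0 : ∀ i j, 0 ≤ R i j) (hR1 : ∀ i j, R i j ≤ 1)
    (hr : ∀ i, ∑ j, w j * R i j ≤ r) :
    ∑ i, ∑ j, (w i * v i ^ p * (v i)⁻¹) * (w j * v j ^ p * (v j)⁻¹) * R i j ≤ r ^ p⁻¹ := by
  have hp0 : 0 < p := by linarith
  have ha : ∀ i, 0 ≤ w i * v i ^ p := fun i ↦ mul_nonneg (hw i) (Real.rpow_nonneg (hv i).le _)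
  have hr0 : 0 ≤ r ^ p⁻¹ := by
    have : Nonempty ι := by
      by_contra h
      rw [not_nonempty_iff] at h
      simp at hw1
    obtain ⟨i⟩ := this
    exact Real.rpow_nonneg
      ((Finset.sum_nonneg fun j _ ↦ mul_nonneg (hw j) (hR0 i j)).trans (hr i)) _
  -- Hölder: the weights `w v^{p-1}` act as a norm-one functional on weighted `ℓ^p`. It is applied
  -- to the rows of `R`, then to the constant `1`.
  have key : ∀ f : ι → ℝ, (∀ i, 0 ≤ f i) →
      ∑ j, w j * v j ^ p * ((v j)⁻¹ * f j) ≤ (∑ j, w j * f j ^ p) ^ p⁻¹ := by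
    intro f hf
    have := Real.inner_le_weight_mul_Lp_of_nonneg Finset.univ hp (fun j ↦ w j * v j ^ p)
      (fun j ↦ (v j)⁻¹ * f j) ha (fun j ↦ mul_nonneg (inv_nonneg.2 (hv j).le) (hf j))
    rw [hwv, Real.one_rpow, one_mul] at this
    refine this.trans_eq ?_
    congr 1
    refine Finset.sum_congr rfl fun j _ ↦ ?_
    have hvp := Real.rpow_pos_of_pos (hv j) p
    rw [Real.mul_rpow (inv_nonneg.2 (hv j).le) (hf j), Real.inv_rpow (hv j).le]
    field_simp
  have hin : ∀ i, ∑ j, w j * v j ^ p * ((v j)⁻¹ * R i j) ≤ r ^ p⁻¹ := by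
    intro i
    refine (key (R i) (hR0 i)).trans (Real.rpow_le_rpow
      (Finset.sum_nonneg fun j _ ↦ mul_nonneg (hw j) (Real.rpow_nonneg (hR0 i j) _))
      ((Finset.sum_le_sum fun j _ ↦ mul_le_mul_of_nonneg_left ?_ (hw j)).trans (hr i))
      (by positivity))
    exact Real.rpow_le_self_of_le_one (hR0 i j) (hR1 i j) hp
  calc _ = ∑ i, w i * v i ^ p * (v i)⁻¹ * ∑ j, w j * v j ^ p * ((v j)⁻¹ * R i j) := by
        refine Finset.sum_congr rfl fun i _ ↦ ?_
        rw [Finset.mul_sum]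
        exact Finset.sum_congr rfl fun j _ ↦ by ring
    _ ≤ ∑ i, w i * v i ^ p * (v i)⁻¹ * r ^ p⁻¹ :=
        Finset.sum_le_sum fun i _ ↦ mul_le_mul_of_nonneg_left (hin i)
          (mul_nonneg (ha i) (inv_nonneg.2 (hv i).le))
    _ = (∑ i, w i * v i ^ p * ((v i)⁻¹ * 1)) * r ^ p⁻¹ := by
        simp only [Finset.sum_mul, mul_one]
    _ ≤ 1 * r ^ p⁻¹ := by
        refine mul_le_mul_of_nonneg_right ((key (fun _ ↦ 1) fun _ ↦ zero_le_one).trans_eq ?_) hr0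
        simp [hw1]
    _ = _ := one_mul _

/-- With `v i = √(x i ^ 2 + ε)` divided by the smoothed norm, `∑ w v^p = 1`, and `|x i| ≤ √(x i ^ 2
+ ε)` bounds the gradient by `w v^{p-1}`, so the Schur bound applies uniformly in `ε` and `x`. -/
theorem sum_sum_abs_smoothLpNormCoeff_le {w : ι → ℝ} {R : ι → ι → ℝ} {p r ε : ℝ} (hp : 1 ≤ p)
    (hε : 0 < ε) (hw : ∀ i, 0 ≤ w i) (hw1 : ∑ i, w i = 1) (hR0 : ∀ i j, 0 ≤ R i j)
    (hR1 : ∀ i j, R i j ≤ 1) (hr : ∀ i, ∑ j, w j * R i j ≤ r) (x : ι → ℝ) :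
    ∑ i, ∑ j, |smoothLpNormCoeff w p ε x i| * |smoothLpNormCoeff w p ε x j| * R i j
      ≤ r ^ p⁻¹ := by
  have hp0 : 0 < p := by linarith
  set S := smoothPowSum w p ε x with hS
  have hS0 : 0 < S := smoothPowSum_pos hw hw1 hε x
  set v : ι → ℝ := fun i ↦ (x i ^ 2 + ε) ^ (1 / 2 : ℝ) / S ^ p⁻¹ with hvdef
  have hv : ∀ i, 0 < v i := fun i ↦ by positivity
  have hvp : ∀ i, v i ^ p = (x i ^ 2 + ε) ^ (p / 2) / S := by
    intro i
    rw [hvdef, Real.div_rpow (by positivity) (by positivity), ← Real.rpow_mul (by positivity),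
      ← Real.rpow_mul hS0.le, inv_mul_cancel₀ hp0.ne', Real.rpow_one]
    congr 2
    ring
  have hwv : ∑ i, w i * v i ^ p = 1 := by
    simp only [hvp, ← mul_div_assoc, ← Finset.sum_div]
    exact div_self hS0.ne'
  have hc : ∀ i, |smoothLpNormCoeff w p ε x i| ≤ w i * v i ^ p * (v i)⁻¹ := by
    intro i
    have hb : 0 < x i ^ 2 + ε := by positivity
    have hx : |x i| ≤ (x i ^ 2 + ε) ^ (1 / 2 : ℝ) := by
      rw [← Real.sqrt_eq_rpow]
      exact Real.abs_le_sqrt (by linarith)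
    have h1 : (x i ^ 2 + ε) ^ (p / 2 - 1) * (x i ^ 2 + ε) ^ (1 / 2 : ℝ)
        = (x i ^ 2 + ε) ^ (p / 2) * ((x i ^ 2 + ε) ^ (1 / 2 : ℝ))⁻¹ := by
      rw [← Real.rpow_neg hb.le, ← Real.rpow_add hb, ← Real.rpow_add hb]
      congr 1
      ring
    have h2 : S ^ (p⁻¹ - 1) = S ^ p⁻¹ / S := by rw [Real.rpow_sub hS0, Real.rpow_one]
    rw [smoothLpNormCoeff, abs_mul, abs_mul, abs_mul, abs_of_nonneg (hw i),
      abs_of_nonneg (Real.rpow_nonneg hb.le _), abs_of_nonneg (Real.rpow_nonneg hS0.le _), hvp]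
    calc _ ≤ S ^ (p⁻¹ - 1) *
          (w i * ((x i ^ 2 + ε) ^ (p / 2 - 1) * (x i ^ 2 + ε) ^ (1 / 2 : ℝ))) := by
          have := hw i
          gcongr
      _ = _ := by
          rw [h1, h2, hvdef]
          field_simp
  refine le_trans (Finset.sum_le_sum fun i _ ↦ Finset.sum_le_sum fun j _ ↦ ?_)
    (sum_sum_mul_le_rpow hp hw hw1 hv hwv hR0 hR1 hr)
  exact mul_le_mul_of_nonneg_right (mul_le_mul (hc i) (hc j) (abs_nonneg _)
    ((abs_nonneg _).trans (hc i))) (hR0 i j)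

/-- The oscillation of the weighted `ℓ^p` norm of a centered Gaussian vector is sub-Gaussian. -/
theorem lintegral_exp_smoothLpNorm_sub_le (μ : Measure (ι → ℝ)) [IsGaussian μ]
    (hμ : ∀ i, ∫ x, x i ∂μ = 0) (hvar : ∀ i, ∫ x, x i ^ 2 ∂μ = 1)
    {w : ι → ℝ} {p r : ℝ} (hp : 1 ≤ p) (hw : ∀ i, 0 ≤ w i) (hw1 : ∑ i, w i = 1)
    (hr : ∀ i, ∑ j, w j * |∫ x, x i * x j ∂μ| ≤ r) (t : ℝ) :
    ∫⁻ z, ENNReal.ofReal (Real.exp (t * (smoothLpNorm w p 0 z.2 - smoothLpNorm w p 0 z.1)))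
      ∂(μ.prod μ) ≤ ENNReal.ofReal (Real.exp (t ^ 2 * (Real.pi ^ 2 / 8) * r ^ p⁻¹)) := by
  have hp0 : 0 < p := by linarith
  have hL2 : ∀ i, MemLp (fun x : ι → ℝ ↦ x i) 2 μ := fun i ↦
    (IsGaussian.hasGaussianLaw_id (μ := μ)).eval i |>.memLp_two
  have hint : ∀ i j, Integrable (fun x : ι → ℝ ↦ x i * x j) μ := fun i j ↦
    (hL2 i).integrable_mul (hL2 j)
  have hid : μ[id] = 0 := by
    funext i
    have := IsGaussian.integral_dual (μ := μ) (ContinuousLinearMap.proj (R := ℝ)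
      (φ := fun _ : ι ↦ ℝ) i)
    simpa [hμ i] using this.symm
  have hR1 : ∀ i j, |∫ x, x i * x j ∂μ| ≤ 1 := by
    intro i j
    have h1 : ∫ x, |x i * x j| ∂μ ≤ ∫ x, (x i ^ 2 + x j ^ 2) / 2 ∂μ := by
      refine integral_mono (hint i j).abs
        (((hL2 i).integrable_sq.add (hL2 j).integrable_sq).div_const 2) fun x ↦ ?_
      rw [abs_mul]
      nlinarith [sq_nonneg (|x i| - |x j|), sq_abs (x i), sq_abs (x j)]
    rw [integral_div, integral_add (hL2 i).integrable_sq (hL2 j).integrable_sq, hvar, hvar] at h1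
    refine (abs_integral_le_integral_abs).trans (h1.trans ?_)
    norm_num
  have hsmooth : ∀ ε : ℝ, 0 < ε →
      ∫⁻ z, ENNReal.ofReal (Real.exp (t * (smoothLpNorm w p ε z.2 - smoothLpNorm w p ε z.1)))
      ∂(μ.prod μ) ≤ ENNReal.ofReal (Real.exp (t ^ 2 * (Real.pi ^ 2 / 8) * r ^ p⁻¹)) := by
    intro ε hε
    refine lintegral_exp_sub_le_of_isGaussian μ hid
      (fun x ↦ hasFDerivAt_smoothLpNorm hw hw1 hp0 hε x) ?_ (fun x ↦ ?_) t
    · exact continuous_finsetSum _ fun i _ ↦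
        (continuous_smoothLpNormCoeff hw hw1 hε i).smul continuous_const
    · set c := smoothLpNormCoeff w p ε x with hc
      rw [variance_eq_integral (by fun_prop)]
      have h0 : ∫ y, (∑ i, c i • ContinuousLinearMap.proj (R := ℝ)
          (φ := fun _ : ι ↦ ℝ) i) y ∂μ = 0 := by
        have := IsGaussian.integral_dual (μ := μ) (∑ i, c i • ContinuousLinearMap.proj (R := ℝ)
          (φ := fun _ : ι ↦ ℝ) i)
        simp only [id_eq] at hid
        rw [this, hid, map_zero]
      rw [h0]
      have h1 : ∀ y : ι → ℝ, ((∑ i, c i • ContinuousLinearMap.proj (R := ℝ)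
          (φ := fun _ : ι ↦ ℝ) i) y - 0) ^ 2 = ∑ i, ∑ j, c i * c j * (y i * y j) := by
        intro y
        simp only [FunLike.coe_sum, Finset.sum_apply, FunLike.coe_smul,
          Pi.smul_apply, ContinuousLinearMap.proj_apply, smul_eq_mul, sub_zero]
        rw [sq, Finset.sum_mul_sum]
        exact Finset.sum_congr rfl fun i _ ↦ Finset.sum_congr rfl fun j _ ↦ by ring
      simp only [h1]
      rw [integral_finsetSum _ fun i _ ↦ integrable_finsetSum _ fun j _ ↦ (hint i j).const_mul _]
      refine le_trans (Finset.sum_le_sum fun i _ ↦ ?_) (sum_sum_abs_smoothLpNormCoeff_le hp hε hw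
        hw1 (fun i j ↦ abs_nonneg (∫ x, x i * x j ∂μ)) hR1 hr x)
      rw [integral_finsetSum _ fun j _ ↦ (hint i j).const_mul _]
      refine Finset.sum_le_sum fun j _ ↦ ?_
      rw [integral_const_mul, ← abs_mul, ← abs_mul]
      exact le_abs_self _
  have hcont := continuous_smoothLpNorm w hp0
  have hlim : ∀ z : (ι → ℝ) × (ι → ℝ), Tendsto (fun n : ℕ ↦ ENNReal.ofReal (Real.exp
      (t * (smoothLpNorm w p (1 / ((n : ℝ) + 1)) z.2 - smoothLpNorm w p (1 / ((n : ℝ) + 1)) z.1))))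
      atTop (𝓝 (ENNReal.ofReal (Real.exp
        (t * (smoothLpNorm w p 0 z.2 - smoothLpNorm w p 0 z.1))))) := by
    intro z
    have h1 : Continuous fun ε : ℝ ↦ ENNReal.ofReal (Real.exp
        (t * (smoothLpNorm w p ε z.2 - smoothLpNorm w p ε z.1))) := by
      have h2 := hcont.comp (Continuous.prodMk_left z.1)
      have h3 := hcont.comp (Continuous.prodMk_left z.2)
      exact ENNReal.continuous_ofReal.comp
        (Real.continuous_exp.comp (continuous_const.mul (h3.sub h2)))
    exact (h1.tendsto 0).comp tendsto_one_div_add_atTop_nhds_zero_nat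
  -- The bound does not depend on `ε`, so Fatou's lemma removes the smoothing.
  calc _ = ∫⁻ z, liminf (fun n : ℕ ↦ ENNReal.ofReal (Real.exp (t * (smoothLpNorm w p
        (1 / ((n : ℝ) + 1)) z.2 - smoothLpNorm w p (1 / ((n : ℝ) + 1)) z.1)))) atTop
        ∂(μ.prod μ) := lintegral_congr fun z ↦ (hlim z).liminf_eq.symm
    _ ≤ liminf (fun n : ℕ ↦ ∫⁻ z, ENNReal.ofReal (Real.exp (t * (smoothLpNorm w p
        (1 / ((n : ℝ) + 1)) z.2 - smoothLpNorm w p (1 / ((n : ℝ) + 1)) z.1)))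
        ∂(μ.prod μ)) atTop := by
        refine lintegral_liminf_le fun n ↦ ?_
        have h2 := hcont.comp (Continuous.prodMk_right (1 / ((n : ℝ) + 1)))
        exact (Real.continuous_exp.comp (continuous_const.mul ((h2.comp continuous_snd).sub
          (h2.comp continuous_fst)))).measurable.ennreal_ofReal
    _ ≤ _ := by
        refine (liminf_le_liminf (Eventually.of_forall fun n : ℕ ↦
          hsmooth (1 / ((n : ℝ) + 1)) Nat.one_div_pos_of_nat)).trans_eq ?_
        exact liminf_const _

end WeightedNorm

/-! ### From symmetrised exponential moments to tails around the `L^p` norm -/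

section Centering

variable {α : Type*} [MeasurableSpace α] {μ : Measure α} [IsProbabilityMeasure μ]

/-- By Tonelli the inner integral is finite for some frozen first argument `x`, and `exp (t * F x)`
is then a harmless constant factor. -/
theorem integrable_exp_of_lintegral_exp_sub {F : α → ℝ} (hF : Measurable F) {t C : ℝ}
    (h : ∫⁻ z, ENNReal.ofReal (Real.exp (t * (F z.2 - F z.1))) ∂(μ.prod μ)
      ≤ ENNReal.ofReal C) : Integrable (fun x ↦ Real.exp (t * F x)) μ := by
  have hmeas : Measurable fun z : α × α ↦
      ENNReal.ofReal (Real.exp (t * (F z.2 - F z.1))) := by fun_prop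
  rw [lintegral_prod _ hmeas.aemeasurable] at h
  have hfin := ae_lt_top hmeas.lintegral_prod_right' (h.trans_lt ENNReal.ofReal_lt_top).ne
  obtain ⟨x, hx⟩ := hfin.exists
  have h1 : Integrable (fun y ↦ Real.exp (t * (F y - F x))) μ := by
    refine ⟨by fun_prop, ?_⟩
    rw [hasFiniteIntegral_iff_ofReal (ae_of_all _ fun y ↦ (Real.exp_pos _).le)]
    exact hx
  refine (h1.const_mul (Real.exp (t * F x))).congr (ae_of_all _ fun y ↦ ?_)
  change Real.exp (t * F x) * Real.exp (t * (F y - F x)) = Real.exp (t * F y)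
  rw [← Real.exp_add]
  congr 1
  ring

/-- Symmetrised exponential moment bounds imply sub-Gaussian deviations from the mean. -/
theorem hasSubgaussianMGF_sub_integral {F : α → ℝ} (hF : Measurable F) {c : ℝ} (hc : 0 ≤ c)
    (h : ∀ t, ∫⁻ z, ENNReal.ofReal (Real.exp (t * (F z.2 - F z.1))) ∂(μ.prod μ)
      ≤ ENNReal.ofReal (Real.exp (t ^ 2 * c))) :
    Integrable F μ ∧
      HasSubgaussianMGF (fun x ↦ F x - ∫ y, F y ∂μ) (2 * c).toNNReal μ := by
  have hexp : ∀ t, Integrable (fun x ↦ Real.exp (t * F x)) μ := fun t ↦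
    integrable_exp_of_lintegral_exp_sub hF (h t)
  have hint : Integrable F μ := by
    have := memLp_of_mem_interior_integrableExpSet (X := F) (μ := μ) (by
      rw [show integrableExpSet F μ = univ from eq_univ_of_forall hexp]
      simp) 1
    exact memLp_one_iff_integrable.1 (by simpa using this)
  refine ⟨hint, ⟨fun t ↦ ?_, fun t ↦ ?_⟩⟩
  · refine ((hexp t).mul_const (Real.exp (-(t * ∫ y, F y ∂μ)))).congr (ae_of_all _ fun x ↦ ?_)
    change Real.exp (t * F x) * Real.exp (-(t * ∫ y, F y ∂μ)) = _
    rw [← Real.exp_add]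
    congr 1
    ring
  · set a := ∫ y, F y ∂μ with ha
    have hprod : (∫ x, Real.exp (-t * F x) ∂μ) * (∫ y, Real.exp (t * F y) ∂μ)
        ≤ Real.exp (t ^ 2 * c) := by
      rw [← integral_prod_mul (μ := μ) (ν := μ) (fun x ↦ Real.exp (-t * F x))
        (fun y ↦ Real.exp (t * F y))]
      have heq : ∀ z : α × α, Real.exp (-t * F z.1) * Real.exp (t * F z.2)
          = Real.exp (t * (F z.2 - F z.1)) := fun z ↦ by
        rw [← Real.exp_add]
        congr 1
        ring
      simp only [heq]
      rw [integral_eq_lintegral_of_nonneg_ae (ae_of_all _ fun z ↦ (Real.exp_pos _).le)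
        (by fun_prop)]
      exact ENNReal.toReal_le_of_le_ofReal (Real.exp_pos _).le (h t)
    -- Jensen replaces the independent copy by the mean.
    have hJ : Real.exp (-t * a) ≤ ∫ x, Real.exp (-t * F x) ∂μ := by
      have := convexOn_exp.map_integral_le (μ := μ) (f := fun x ↦ -t * F x)
        Real.continuous_exp.continuousOn isClosed_univ (by simp) (hint.const_mul _) (hexp (-t))
      rwa [integral_const_mul] at this
    have hmgf : mgf (fun x ↦ F x - a) μ t = Real.exp (-t * a) * ∫ y, Real.exp (t * F y) ∂μ := by
      rw [mgf, ← integral_const_mul]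
      refine integral_congr_ae (ae_of_all _ fun x ↦ ?_)
      change Real.exp (t * (F x - a)) = Real.exp (-t * a) * Real.exp (t * F x)
      rw [← Real.exp_add]
      congr 1
      ring
    rw [hmgf, Real.coe_toNNReal _ (by positivity)]
    calc _ ≤ _ := mul_le_mul_of_nonneg_right hJ (integral_nonneg fun y ↦ (Real.exp_pos _).le)
      _ ≤ Real.exp (t ^ 2 * c) := hprod
      _ = _ := by
        congr 1
        ring

/-- The distance between the mean and the `p`-th moment norm of a nonnegative sub-Gaussian
variable is of the order of its standard deviation. -/
theorem abs_integral_sub_rpow_le {F : α → ℝ} (hF0 : ∀ x, 0 ≤ F x) {p s K : ℝ}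
    (hp : 1 ≤ p) (hs : 0 < s) (hK : 0 ≤ K) (hint : Integrable F μ)
    (h : HasSubgaussianMGF (fun x ↦ F x - ∫ y, F y ∂μ) (2 * (K * s)).toNNReal μ) :
    |(∫ x, F x ^ p ∂μ) ^ p⁻¹ - ∫ x, F x ∂μ| ≤ p * (2 * Real.exp K) ^ p⁻¹ * √s := by
  have hp0 : 0 < p := by linarith
  set a := ∫ y, F y ∂μ with ha
  have ha0 : 0 ≤ a := integral_nonneg hF0
  have hsq : 0 < √s := Real.sqrt_pos.2 hs
  have hsqne : (√s)⁻¹ ≠ 0 := (inv_pos.2 hsq).ne'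
  -- The exponent `1/√s` matches the sub-Gaussian scale, so that both exponential moments are at
  -- most `exp K`.
  have hbound : ∀ x, |F x - a| ^ p ≤ (p * √s) ^ p *
      (Real.exp ((√s)⁻¹ * (F x - a)) + Real.exp (-(√s)⁻¹ * (F x - a))) := by
    intro x
    refine (rpow_abs_le_mul_exp_abs (F x - a) hp0.le hsqne).trans ?_
    rw [abs_of_pos (inv_pos.2 hsq), div_inv_eq_mul]
    refine mul_le_mul_of_nonneg_left ?_ (by positivity)
    rcases abs_cases (F x - a) with ⟨h1, _⟩ | ⟨h1, _⟩ <;> rw [h1]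
    · linarith [Real.exp_pos (-(√s)⁻¹ * (F x - a))]
    · rw [mul_neg, ← neg_mul]
      linarith [Real.exp_pos ((√s)⁻¹ * (F x - a))]
  have hi1 := h.integrable_exp_mul (√s)⁻¹
  have hi2 := h.integrable_exp_mul (-(√s)⁻¹)
  have hm : ∀ t, t ^ 2 = s⁻¹ → ∫ x, Real.exp (t * (F x - a)) ∂μ ≤ Real.exp K := by
    intro t ht
    refine (h.mgf_le t).trans_eq ?_
    rw [Real.coe_toNNReal _ (by positivity), ht]
    congr 1
    field_simp
  have hsq2 : ((√s)⁻¹) ^ 2 = s⁻¹ := by rw [inv_pow, Real.sq_sqrt hs.le]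
  have hmom : ∫ x, |F x - a| ^ p ∂μ ≤ (p * √s) ^ p * (2 * Real.exp K) := by
    calc _ ≤ ∫ x, (p * √s) ^ p *
          (Real.exp ((√s)⁻¹ * (F x - a)) + Real.exp (-(√s)⁻¹ * (F x - a))) ∂μ :=
          integral_mono_of_nonneg (ae_of_all _ fun x ↦ by positivity)
            ((hi1.add hi2).const_mul _) (ae_of_all _ hbound)
      _ ≤ _ := by
          rw [integral_const_mul, integral_add hi1 hi2]
          refine mul_le_mul_of_nonneg_left ?_ (by positivity)
          linarith [hm _ hsq2, hm (-(√s)⁻¹) (by rw [neg_sq, hsq2])]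
  have hmeas : AEStronglyMeasurable F μ := hint.aestronglyMeasurable
  have hpne : ENNReal.ofReal p ≠ 0 := by simpa using hp0
  have hptop : ENNReal.ofReal p ≠ ⊤ := ENNReal.ofReal_ne_top
  have hp1 : 1 ≤ ENNReal.ofReal p := by simpa using hp
  have hptr : (ENNReal.ofReal p).toReal = p := ENNReal.toReal_ofReal hp0.le
  have hD : MemLp (fun x ↦ F x - a) (ENNReal.ofReal p) μ := by
    rw [← integrable_norm_rpow_iff (by fun_prop) hpne hptop, hptr]
    simp only [Real.norm_eq_abs]
    refine Integrable.mono' ((hi1.add hi2).const_mul ((p * √s) ^ p))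
      ((by fun_prop : AEMeasurable (fun x ↦ |F x - a| ^ p) μ).aestronglyMeasurable)
      (ae_of_all _ fun x ↦ ?_)
    rw [Real.norm_of_nonneg (by positivity)]
    exact hbound x
  have hcst : MemLp (fun _ : α ↦ a) (ENNReal.ofReal p) μ := memLp_const a
  have hFm : MemLp F (ENNReal.ofReal p) μ := by
    convert hD.add hcst using 1
    ext x
    simp
  have e1 : lpNorm F (ENNReal.ofReal p) μ = (∫ x, F x ^ p ∂μ) ^ p⁻¹ := by
    rw [lpNorm_eq_integral_norm_rpow_toReal hpne hptop hmeas, hptr]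
    simp only [Real.norm_eq_abs, abs_of_nonneg (hF0 _)]
  have e2 : lpNorm (fun _ : α ↦ a) (ENNReal.ofReal p) μ = a := by
    rw [lpNorm_const' hpne hptop]
    simp [ha0]
  have e3 : lpNorm (F - fun _ ↦ a) (ENNReal.ofReal p) μ ≤ p * (2 * Real.exp K) ^ p⁻¹ * √s := by
    rw [lpNorm_eq_integral_norm_rpow_toReal hpne hptop (hmeas.sub (by fun_prop)), hptr]
    simp only [Real.norm_eq_abs, Pi.sub_apply]
    refine (Real.rpow_le_rpow (integral_nonneg fun x ↦ by positivity) hmom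
      (by positivity)).trans_eq ?_
    rw [Real.mul_rpow (by positivity) (by positivity), ← Real.rpow_mul (by positivity),
      mul_inv_cancel₀ hp0.ne', Real.rpow_one]
    ring
  have t1 := lpNorm_le_lpNorm_add_lpNorm_sub (f := F) (g := fun _ ↦ a) hcst hp1
  have t2 := lpNorm_le_lpNorm_add_lpNorm_sub (f := fun _ ↦ a) (g := F) hFm hp1
  rw [lpNorm_sub_comm] at t1
  rw [e1, e2] at t1 t2
  rw [abs_le]
  constructor <;> linarith

/-- The mean of `F` is not explicit, whereas its `p`-th moment will be; recentering there costs only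
a term of order `√s`. -/
theorem measureReal_abs_sub_rpow_ge_le {F : α → ℝ} (hF : Measurable F) (hF0 : ∀ x, 0 ≤ F x)
    {p s K τ : ℝ} (hp : 1 ≤ p) (hs : 0 < s) (hK : 0 ≤ K) (hτ : 0 ≤ τ)
    (h : ∀ t, ∫⁻ z, ENNReal.ofReal (Real.exp (t * (F z.2 - F z.1))) ∂(μ.prod μ)
      ≤ ENNReal.ofReal (Real.exp (t ^ 2 * (K * s)))) :
    μ.real {x | p * (2 * Real.exp K) ^ p⁻¹ * √s + τ ≤ |F x - (∫ x, F x ^ p ∂μ) ^ p⁻¹|}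
      ≤ 2 * Real.exp (-τ ^ 2 / (4 * (K * s))) := by
  obtain ⟨hint, hsub⟩ := hasSubgaussianMGF_sub_integral hF (by positivity) h
  have hc := abs_integral_sub_rpow_le hF0 hp hs hK hint hsub
  have h1 := hsub.measure_ge_le hτ
  have h2 := hsub.neg.measure_ge_le hτ
  rw [Real.coe_toNNReal _ (by positivity), show 2 * (2 * (K * s)) = 4 * (K * s) by ring]
    at h1 h2
  refine (measureReal_mono (s₂ := {x | τ ≤ F x - ∫ y, F y ∂μ} ∪
    {x | τ ≤ (-fun x ↦ F x - ∫ y, F y ∂μ) x}) fun x hx ↦ ?_).trans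
    ((measureReal_union_le _ _).trans (by linarith))
  simp only [mem_ofPred_eq, mem_union, Pi.neg_apply] at hx ⊢
  have := abs_sub_le (F x) (∫ y, F y ∂μ) ((∫ x, F x ^ p ∂μ) ^ p⁻¹)
  rw [abs_sub_comm (∫ y, F y ∂μ)] at this
  rcases abs_cases (F x - ∫ y, F y ∂μ) with ⟨h3, _⟩ | ⟨h3, _⟩
  · left; linarith
  · right; linarith

end Centering

/-! ### Concentration of the weighted `ℓ^p` norm of a Gaussian vector -/

section GaussianVector

variable {ι : Type*} [Fintype ι]

theorem continuous_smoothLpNorm_right (w : ι → ℝ) {p : ℝ} (hp : 0 < p) (ε : ℝ) :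
    Continuous (smoothLpNorm w p ε) := by
  unfold smoothLpNorm smoothPowSum
  refine Continuous.rpow_const (continuous_finsetSum _ fun i _ ↦ ?_)
    fun _ ↦ Or.inr (by positivity)
  exact continuous_const.mul
    (Continuous.rpow_const (by fun_prop) fun _ ↦ Or.inr (by positivity))

theorem integral_smoothPowSum_zero (μ : Measure (ι → ℝ)) [IsGaussian μ]
    (hμ : ∀ i, ∫ x, x i ∂μ = 0) (hvar : ∀ i, ∫ x, x i ^ 2 ∂μ = 1)
    {w : ι → ℝ} {p : ℝ} (hp : 0 ≤ p) (hw1 : ∑ i, w i = 1) :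
    ∫ x, smoothPowSum w p 0 x ∂μ = ∫ y, |y| ^ p ∂(gaussianReal 0 1) := by
  simp only [smoothPowSum_zero]
  have hlaw : ∀ i, μ.map (fun x ↦ x i) = gaussianReal 0 1 := by
    intro i
    have h1 := ((IsGaussian.hasGaussianLaw_id (μ := μ)).eval i).map_eq_gaussianReal
    simp only [id_eq] at h1
    rw [hμ, variance_eq_integral (measurable_pi_apply i).aemeasurable, hμ] at h1
    simpa [hvar] using h1
  have hmeas : Measurable fun y : ℝ ↦ |y| ^ p := by fun_prop
  have hg : Integrable (fun y : ℝ ↦ |y| ^ p) (gaussianReal 0 1) := by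
    refine integrable_rpow_abs_of_mem_interior_integrableExpSet (X := fun y : ℝ ↦ y) ?_ hp
    rw [show integrableExpSet (fun y : ℝ ↦ y) (gaussianReal 0 1) = univ from
      eq_univ_of_forall fun t ↦ integrable_exp_mul_gaussianReal t]
    simp
  have hi : ∀ i, Integrable (fun x : ι → ℝ ↦ |x i| ^ p) μ := by
    intro i
    have h2 := hg
    rw [← hlaw i] at h2
    exact h2.comp_measurable (measurable_pi_apply i)
  rw [integral_finsetSum _ fun i _ ↦ (hi i).const_mul _]
  have : ∀ i, ∫ x, w i * |x i| ^ p ∂μ = w i * ∫ y, |y| ^ p ∂(gaussianReal 0 1) := by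
    intro i
    rw [integral_const_mul, ← hlaw i, integral_map (measurable_pi_apply i).aemeasurable hmeas.aestronglyMeasurable]
  rw [Finset.sum_congr rfl fun i _ ↦ this i, ← Finset.sum_mul, hw1, one_mul]

/-- Concentration of the weighted `ℓ^p` norm of a centered Gaussian vector with unit variances
around the `L^p` norm of a standard normal variable. -/
theorem measureReal_smoothLpNorm_deviation_le (μ : Measure (ι → ℝ)) [IsGaussian μ]
    (hμ : ∀ i, ∫ x, x i ∂μ = 0) (hvar : ∀ i, ∫ x, x i ^ 2 ∂μ = 1)
    {w : ι → ℝ} {p r τ : ℝ} (hp : 1 ≤ p) (hw : ∀ i, 0 ≤ w i) (hw1 : ∑ i, w i = 1) (hr0 : 0 < r)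
    (hr : ∀ i, ∑ j, w j * |∫ x, x i * x j ∂μ| ≤ r) (hτ : 0 ≤ τ) :
    μ.real {x | p * (2 * Real.exp (Real.pi ^ 2 / 8)) ^ p⁻¹ * √(r ^ p⁻¹) + τ ≤
        |smoothLpNorm w p 0 x - (∫ y, |y| ^ p ∂(gaussianReal 0 1)) ^ p⁻¹|}
      ≤ 2 * Real.exp (-τ ^ 2 / (4 * (Real.pi ^ 2 / 8 * r ^ p⁻¹))) := by
  have hp0 : 0 < p := by linarith
  have hS : ∀ x, 0 ≤ smoothPowSum w p 0 x := smoothPowSum_nonneg hw p le_rfl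
  have hF : Continuous (smoothLpNorm w p 0) := continuous_smoothLpNorm_right w hp0 0
  have hF0 : ∀ x, 0 ≤ smoothLpNorm w p 0 x := fun x ↦ Real.rpow_nonneg (hS x) _
  have hexp : ∀ t, ∫⁻ z, ENNReal.ofReal
      (Real.exp (t * (smoothLpNorm w p 0 z.2 - smoothLpNorm w p 0 z.1))) ∂(μ.prod μ)
      ≤ ENNReal.ofReal (Real.exp (t ^ 2 * (Real.pi ^ 2 / 8 * r ^ p⁻¹))) := by
    intro t
    rw [← mul_assoc (t ^ 2)]
    exact lintegral_exp_smoothLpNorm_sub_le μ hμ hvar hp hw hw1 hr t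
  have h := measureReal_abs_sub_rpow_ge_le (μ := μ) hF.measurable hF0 hp
    (Real.rpow_pos_of_pos hr0 p⁻¹) (K := Real.pi ^ 2 / 8) (by positivity) hτ hexp
  have he : ∀ x, smoothLpNorm w p 0 x ^ p = smoothPowSum w p 0 x := by
    intro x
    rw [smoothLpNorm, ← Real.rpow_mul (hS x), inv_mul_cancel₀ hp0.ne', Real.rpow_one]
  simp only [he] at h
  rwa [integral_smoothPowSum_zero μ hμ hvar hp0.le hw1] at h

end GaussianVector

/-! ### Increments and second differences of concave functions -/

section Concave

variable {φ : ℝ → ℝ} {δ : ℝ}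

/-- Both `s` and `t - h` are convex combinations of `s - h` and `t`, with exchanged weights; adding
the two concavity inequalities gives the claim. -/
theorem ConcaveOn.increment_anti (hφ : ConcaveOn ℝ (Icc 0 δ) φ) {h s t : ℝ} (hh : 0 ≤ h)
    (hs : h ≤ s) (hst : s ≤ t) (ht : t ≤ δ) : φ t - φ (t - h) ≤ φ s - φ (s - h) := by
  rcases hh.eq_or_lt with rfl | hpos
  · simp
  have hD : 0 < t - s + h := by linarith
  have hx : s - h ∈ Icc 0 δ := ⟨by linarith, by linarith⟩
  have hy : t ∈ Icc 0 δ := ⟨by linarith, ht⟩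
  have ha : 0 ≤ (t - s) / (t - s + h) := div_nonneg (by linarith) hD.le
  have hb : 0 ≤ h / (t - s + h) := by positivity
  have hab : (t - s) / (t - s + h) + h / (t - s + h) = 1 := by field_simp
  have h1 := hφ.2 hx hy ha hb hab
  have h2 := hφ.2 hx hy hb ha (by linarith)
  simp only [smul_eq_mul] at h1 h2
  have e1 : (t - s) / (t - s + h) * (s - h) + h / (t - s + h) * t = s := by
    field_simp
    ring
  have e2 : h / (t - s + h) * (s - h) + (t - s) / (t - s + h) * t = t - h := by
    field_simp
    ring
  rw [e1] at h1
  rw [e2] at h2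
  have e3 : (t - s) / (t - s + h) * φ (s - h) + h / (t - s + h) * φ t
      + (h / (t - s + h) * φ (s - h) + (t - s) / (t - s + h) * φ t) = φ (s - h) + φ t := by
    field_simp
    ring
  linarith

theorem ConcaveOn.increment_le (hφ : ConcaveOn ℝ (Icc 0 δ) φ) (h0 : φ 0 = 0) {h s : ℝ}
    (hh : 0 ≤ h) (hs : h ≤ s) (ht : s ≤ δ) : φ s - φ (s - h) ≤ φ h := by
  simpa [h0] using hφ.increment_anti hh le_rfl hs ht

theorem ConcaveOn.pos_of_ne_zero (hφ : ConcaveOn ℝ (Icc 0 δ) φ) (hm : MonotoneOn φ (Icc 0 δ))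
    (h0 : φ 0 = 0) (hne : ∃ h ∈ Icc 0 δ, φ h ≠ 0) {h : ℝ} (hh : 0 < h) (hδ : h ≤ δ) :
    0 < φ h := by
  obtain ⟨u, hu, hune⟩ := hne
  have hupos : 0 < u := hu.1.lt_of_ne fun h ↦ hune (h ▸ h0)
  have hδ0 : (0 : ℝ) ∈ Icc 0 δ := ⟨le_rfl, hh.le.trans hδ⟩
  have hφu : 0 < φ u := lt_of_le_of_ne (h0 ▸ hm hδ0 hu hu.1) hune.symm
  rcases le_total u h with huh | huh
  · exact hφu.trans_le (hm hu ⟨hh.le, hδ⟩ huh)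
  · have ha : 0 ≤ 1 - h / u := sub_nonneg.2 ((div_le_one hupos).2 huh)
    have hb : 0 ≤ h / u := by positivity
    have h1 := hφ.2 hδ0 hu ha hb (by ring)
    simp only [smul_eq_mul, h0, mul_zero, zero_add] at h1
    rw [div_mul_cancel₀ _ hupos.ne'] at h1
    exact lt_of_lt_of_le (by positivity) h1

/-- Telescoping with lag `m`: only the first `m` terms survive, minus a nonnegative tail. -/
theorem sum_Ico_sub_shift_le {g : ℕ → ℝ} {m K : ℕ} (hg : ∀ k, m ≤ k → k < K + m → 0 ≤ g k)
    (hmK : m ≤ K) : ∑ k ∈ Finset.Ico m K, (g k - g (k + m)) ≤ ∑ k ∈ Finset.Ico m (2 * m), g k := by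
  rw [Finset.sum_sub_distrib, Finset.sum_Ico_add' g m K m]
  have h1 : ∑ k ∈ Finset.Ico m (K + m), g k
      = ∑ k ∈ Finset.Ico m (2 * m), g k + ∑ k ∈ Finset.Ico (m + m) (K + m), g k := by
    rw [← two_mul]
    exact (Finset.sum_Ico_consecutive g (by omega) (by omega)).symm
  have h2 : ∑ k ∈ Finset.Ico m K, g k ≤ ∑ k ∈ Finset.Ico m (K + m), g k := by
    refine Finset.sum_le_sum_of_subset_of_nonneg
      (Finset.Ico_subset_Ico le_rfl (Nat.le_add_right _ _)) fun k hk _ ↦ ?_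
    rw [Finset.mem_Ico] at hk
    exact hg k hk.1 hk.2
  linarith

/-- The second differences, at scale `h`, of an even function that is concave and increasing near
`0` sum up along a grid to at most a constant times the number of grid points in `[0, h]`. -/
theorem sum_range_abs_second_difference_le (hφ : ConcaveOn ℝ (Icc 0 δ) φ)
    (hm : MonotoneOn φ (Icc 0 δ)) (h0 : φ 0 = 0) (heven : ∀ s, φ (-s) = φ s) {h κ L : ℝ} {N : ℕ}
    (hκ : 0 < κ) (hκh : κ ≤ h) (hL : N * κ ≤ L) (hL0 : 0 ≤ L) (hδ : L + 3 * h ≤ δ) :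
    ∑ k ∈ Finset.range N, |φ (k * κ + h) + φ (k * κ - h) - 2 * φ (k * κ)|
      ≤ 6 * (h / κ) * φ h := by
  have hh : 0 < h := by linarith
  have hmem : ∀ {s : ℝ}, 0 ≤ s → s ≤ L + 3 * h → s ∈ Icc 0 δ := fun h1 h2 ↦ ⟨h1, h2.trans hδ⟩
  have hnn : ∀ {s : ℝ}, 0 ≤ s → s ≤ L + 3 * h → 0 ≤ φ s := fun h1 h2 ↦ by
    have := hm (hmem le_rfl (by linarith)) (hmem h1 h2) h1
    rwa [h0] at this
  set D : ℕ → ℝ := fun k ↦ |φ (k * κ + h) + φ (k * κ - h) - 2 * φ (k * κ)| with hD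
  -- Grid points below index `m` may lie within `h` of `0`, where evenness enters and each term is
  -- bounded crudely. From `m` on, `k * κ ≥ h` and concavity applies to every increment.
  set m : ℕ := ⌈h / κ⌉₊ with hmdef
  have hm1 : h ≤ m * κ := by
    have := Nat.le_ceil (h / κ)
    rwa [div_le_iff₀ hκ] at this
  have hm2 : m * κ < h + κ := by
    have := Nat.ceil_lt_add_one (div_nonneg hh.le hκ.le)
    rw [← hmdef] at this
    have := mul_lt_mul_of_pos_right this hκ
    rwa [add_mul, div_mul_cancel₀ _ hκ.ne', one_mul] at this
  have hsmall : ∀ k ∈ Finset.range m, D k ≤ 2 * φ h := by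
    intro k hk
    rw [Finset.mem_range] at hk
    have hk1 : (k : ℝ) + 1 ≤ m := by exact_mod_cast hk
    have hk0 : (0 : ℝ) ≤ k * κ := by positivity
    have hkh : k * κ < h := by nlinarith
    set s := k * κ
    have e1 := hφ.increment_le h0 (h := h) (s := s + h) hh.le (by linarith) (by linarith)
    rw [add_sub_cancel_right] at e1
    have e2 : φ (s - h) = φ (h - s) := by rw [← heven, neg_sub]
    have e3 : φ (h - s) ≤ φ h := hm (hmem (by linarith) (by linarith))
      (hmem hh.le (by linarith)) (by linarith)
    have e4 : φ s ≤ φ h := hm (hmem hk0 (by linarith)) (hmem hh.le (by linarith)) hkh.le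
    have e5 : 0 ≤ φ s := hnn hk0 (by linarith)
    have e6 : 0 ≤ φ (h - s) := hnn (by linarith) (by linarith)
    have e7 : 0 ≤ φ (s + h) := hnn (by linarith) (by linarith)
    change |φ (s + h) + φ (s - h) - 2 * φ s| ≤ 2 * φ h
    rw [e2, abs_le]
    constructor <;> linarith
  have hlarge : ∑ k ∈ Finset.Ico m N, D k ≤ m * φ h := by
    rcases le_total N m with hNm | hNm
    · rw [Finset.Ico_eq_empty_of_le hNm, Finset.sum_empty]
      exact mul_nonneg (Nat.cast_nonneg _) (hnn hh.le (by linarith))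
    set g : ℕ → ℝ := fun k ↦ φ (k * κ) - φ (k * κ - h) with hg
    have hNL : ∀ {k : ℕ}, k < N → (k : ℝ) * κ ≤ L := fun hk ↦
      (mul_le_mul_of_nonneg_right (Nat.cast_le.2 hk.le) hκ.le).trans hL
    have hkm : ∀ {k : ℕ}, m ≤ k → h ≤ k * κ := fun hk ↦
      hm1.trans (mul_le_mul_of_nonneg_right (Nat.cast_le.2 hk) hκ.le)
    -- The second difference is minus the drop between consecutive increments of length `h`. Since
    -- `m * κ ≥ h`, the increment ending at `(k + m) * κ` is smaller still.
    have hstep : ∀ k ∈ Finset.Ico m N, D k ≤ g k - g (k + m) := by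
      intro k hk
      rw [Finset.mem_Ico] at hk
      have hk1 := hkm hk.1
      have hk2 := hNL hk.2
      have hcast : ((k + m : ℕ) : ℝ) * κ = k * κ + m * κ := by push_cast; ring
      have e1 := hφ.increment_anti (h := h) (s := k * κ) (t := k * κ + h) hh.le hk1
        (by linarith) (by linarith)
      have e2 := hφ.increment_anti (h := h) (s := k * κ + h) (t := k * κ + m * κ) hh.le
        (by linarith) (by linarith) (by linarith)
      rw [add_sub_cancel_right] at e1 e2
      simp only [hg, hD, hcast]
      rw [abs_le]
      constructor <;> linarith
    refine (Finset.sum_le_sum hstep).trans ((sum_Ico_sub_shift_le (fun k hk1 hk2 ↦ ?_) hNm).trans ?_)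
    · have h1 := hkm hk1
      have h2 : (k : ℝ) + 1 ≤ N + m := by exact_mod_cast hk2
      have h3 : (k : ℝ) * κ ≤ L + 2 * h := by nlinarith
      exact sub_nonneg.2 (hm (hmem (by linarith) (by linarith)) (hmem (by linarith) (by linarith))
        (by linarith))
    · calc _ ≤ ∑ _k ∈ Finset.Ico m (2 * m), φ h := by
            refine Finset.sum_le_sum fun k hk ↦ ?_
            rw [Finset.mem_Ico] at hk
            have h1 := hkm hk.1
            have h2 : (k : ℝ) + 1 ≤ 2 * m := by exact_mod_cast hk.2
            have h3 : (k : ℝ) * κ ≤ 3 * h := by nlinarith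
            exact hφ.increment_le h0 hh.le h1 (by linarith)
        _ = m * φ h := by
            rw [Finset.sum_const, Nat.card_Ico, show 2 * m - m = m by omega, nsmul_eq_mul]
  have hmκ : (m : ℝ) ≤ 2 * (h / κ) := by
    rw [← mul_div_assoc, le_div_iff₀ hκ]
    linarith
  have hφh : 0 ≤ φ h := hnn hh.le (by linarith)
  calc ∑ k ∈ Finset.range N, D k ≤ ∑ k ∈ Finset.range m ∪ Finset.Ico m N, D k := by
        refine Finset.sum_le_sum_of_subset_of_nonneg (fun k hk ↦ ?_) fun k _ _ ↦ abs_nonneg _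
        simp only [Finset.mem_union, Finset.mem_range, Finset.mem_Ico] at hk ⊢
        omega
    _ = ∑ k ∈ Finset.range m, D k + ∑ k ∈ Finset.Ico m N, D k := by
        refine Finset.sum_union (Finset.disjoint_left.2 fun k hk hk' ↦ ?_)
        simp only [Finset.mem_range, Finset.mem_Ico] at hk hk'
        omega
    _ ≤ m * (2 * φ h) + m * φ h := by
        refine add_le_add ((Finset.sum_le_sum hsmall).trans_eq ?_) hlarge
        simp
    _ = 3 * m * φ h := by ring
    _ ≤ _ := by nlinarith

/-- A row of a symmetric Toeplitz matrix is split at the diagonal; each side is part of the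
one-sided sum. -/
theorem sum_range_abs_sub_le {ρ : ℤ → ℝ} (hρ : ∀ k, 0 ≤ ρ k) (heven : ∀ k, ρ (-k) = ρ k)
    {N i : ℕ} (hi : i < N) :
    ∑ j ∈ Finset.range N, ρ ((i : ℤ) - j) ≤ 2 * ∑ k ∈ Finset.range N, ρ k := by
  rw [← Finset.sum_range_add_sum_Ico _ hi.le, two_mul]
  refine add_le_add ?_ ?_
  · rw [← Finset.sum_range_reflect]
    calc _ = ∑ k ∈ Finset.range i, ρ ((k + 1 : ℕ) : ℤ) := by
          refine Finset.sum_congr rfl fun k hk ↦ ?_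
          rw [Finset.mem_range] at hk
          congr 1
          omega
      _ ≤ ∑ k ∈ Finset.range (i + 1), ρ k := by
          rw [Finset.sum_range_succ' (fun k : ℕ ↦ ρ k)]
          linarith [hρ ((0 : ℕ) : ℤ)]
      _ ≤ _ := Finset.sum_le_sum_of_subset_of_nonneg
          (Finset.range_subset_range.2 hi) fun k _ _ ↦ hρ _
  · rw [Finset.sum_Ico_eq_sum_range]
    calc _ = ∑ k ∈ Finset.range (N - i), ρ k := by
          refine Finset.sum_congr rfl fun k _ ↦ ?_
          rw [← heven]
          congr 1
          push_cast
          ring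
      _ ≤ _ := Finset.sum_le_sum_of_subset_of_nonneg
          (Finset.range_subset_range.2 (Nat.sub_le _ _)) fun k _ _ ↦ hρ _

end Concave

/-! ### Riemann sums -/

section Riemann

/-- Left Riemann sums of a continuous function converge to its mean. -/
theorem tendsto_riemann_sum {f : ℝ → ℝ} (hf : Continuous f) (a : ℝ) {L : ℝ} (hL : 0 < L) :
    Tendsto (fun N : ℕ ↦ ∑ i ∈ Finset.range N, (1 / (N : ℝ)) * f (a + i * (L / N))) atTop
      (𝓝 ((1 / L) * ∫ x in a..(a + L), f x)) := by
  rw [Metric.tendsto_atTop]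
  intro ε hε
  have huc := (isCompact_Icc (a := a) (b := a + L)).uniformContinuousOn_of_continuous
    hf.continuousOn
  rw [Metric.uniformContinuousOn_iff] at huc
  obtain ⟨η, hη, H⟩ := huc (ε / 2) (by linarith)
  obtain ⟨N₀, hN₀⟩ := exists_nat_gt (L / η)
  refine ⟨N₀ + 1, fun N hN ↦ ?_⟩
  have hN0 : (0 : ℝ) < N := by
    have : 0 < N := by omega
    exact_mod_cast this
  have hκη : L / N < η := by
    rw [div_lt_iff₀ hN0]
    rw [div_lt_iff₀ hη] at hN₀
    have : (N₀ : ℝ) ≤ N := by exact_mod_cast (by omega : N₀ ≤ N)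
    nlinarith
  set κ := L / N with hκ
  have hκ0 : 0 < κ := by positivity
  have hNκ : N * κ = L := by rw [hκ]; field_simp
  have hadj := intervalIntegral.sum_integral_adjacent_intervals (μ := volume) (f := f)
    (a := fun i : ℕ ↦ a + i * κ) (n := N) fun k _ ↦ hf.intervalIntegrable _ _
  simp only [Nat.cast_zero, zero_mul, add_zero, hNκ] at hadj
  rw [Real.dist_eq, ← hadj, Finset.mul_sum, ← Finset.sum_sub_distrib]
  have hterm : ∀ i ∈ Finset.range N, |1 / (N : ℝ) * f (a + i * κ) -
      1 / L * ∫ x in (a + i * κ)..(a + (i + 1 : ℕ) * κ), f x| ≤ 1 / N * (ε / 2) := by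
    intro i hi
    rw [Finset.mem_range] at hi
    have hi1 : (i : ℝ) + 1 ≤ N := by exact_mod_cast hi
    have hlen : a + (i + 1 : ℕ) * κ - (a + i * κ) = κ := by push_cast; ring
    have hle : a + i * κ ≤ a + (i + 1 : ℕ) * κ := by linarith
    have hi2 : (i : ℝ) * κ + κ ≤ L := by nlinarith
    have hi3 : (0 : ℝ) ≤ i * κ := by positivity
    have h1 : 1 / (N : ℝ) * f (a + i * κ)
        = 1 / L * ∫ x in (a + i * κ)..(a + (i + 1 : ℕ) * κ), f (a + i * κ) := by
      rw [intervalIntegral.integral_const, hlen, hκ, smul_eq_mul]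
      field_simp
    rw [h1, ← mul_sub, ← intervalIntegral.integral_sub (by simp) (hf.intervalIntegrable _ _),
      abs_mul, abs_of_pos (by positivity : (0 : ℝ) < 1 / L)]
    have h2 := intervalIntegral.norm_integral_le_of_norm_le_const (C := ε / 2)
      (f := fun x ↦ f (a + i * κ) - f x) (a := a + i * κ) (b := a + (i + 1 : ℕ) * κ) (by
        intro x hx
        rw [uIoc_of_le hle] at hx
        have hx2 : x ≤ a + i * κ + κ := by linarith [hx.2]
        refine (H (a + i * κ) ⟨by linarith, by linarith⟩ x
          ⟨by linarith [hx.1], by linarith⟩ ?_).le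
        rw [Real.dist_eq, abs_lt]
        constructor <;> linarith [hx.1])
    rw [hlen, abs_of_pos hκ0] at h2
    calc _ ≤ 1 / L * (ε / 2 * κ) := mul_le_mul_of_nonneg_left h2 (by positivity)
      _ = _ := by rw [hκ]; field_simp
  calc _ ≤ ∑ i ∈ Finset.range N, 1 / (N : ℝ) * (ε / 2) :=
        (Finset.abs_sum_le_sum_abs _ _).trans (Finset.sum_le_sum hterm)
    _ = ε / 2 := by
        rw [Finset.sum_const, Finset.card_range, nsmul_eq_mul]
        field_simp
    _ < ε := by linarith

end Riemann

/-! ### Covariances and deviation bounds for the increments of the process -/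

section Increments

variable {Ω : Type*} [MeasurableSpace Ω] {P : Measure Ω} {G : ℝ → Ω → ℝ}

theorem incrementVar_zero : incrementVar G P 0 = 0 := by simp [incrementVar]

theorem integral_sub_sq_eq_incrementVar (hstat : HasStationaryIncrements G P) (u v : ℝ) :
    ∫ ω, (G u ω - G v ω) ^ 2 ∂P = incrementVar G P (u - v) := by
  have := incrementVar_eq hstat v (u - v)
  rwa [add_sub_cancel] at this

theorem incrementVar_neg (hstat : HasStationaryIncrements G P) (h : ℝ) :
    incrementVar G P (-h) = incrementVar G P h := by
  rw [← zero_sub, ← integral_sub_sq_eq_incrementVar hstat 0 h, incrementVar]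
  exact integral_congr_ae (ae_of_all _ fun ω ↦ by ring)

theorem IsGaussianProcess.memLp_sub (hGauss : IsGaussianProcess G P) (u v : ℝ) :
    MemLp (fun ω ↦ G u ω - G v ω) 2 P :=
  (hGauss.hasGaussianLaw_eval u).memLp_two.sub (hGauss.hasGaussianLaw_eval v).memLp_two

/-- Polarization: the product is a combination of four squared increments, so covariances become
second differences of `σ²`. -/
theorem integral_increment_mul_increment (hGauss : IsGaussianProcess G P)
    (hstat : HasStationaryIncrements G P) (x y h : ℝ) :
    ∫ ω, (G (x + h) ω - G x ω) * (G (y + h) ω - G y ω) ∂P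
      = (incrementVar G P (x - y + h) + incrementVar G P (x - y - h)
        - 2 * incrementVar G P (x - y)) / 2 := by
  have hi : ∀ u v, Integrable (fun ω ↦ (G u ω - G v ω) ^ 2) P := fun u v ↦
    (IsGaussianProcess.memLp_sub hGauss u v).integrable_sq
  have h1 : ∀ ω, (G (x + h) ω - G x ω) * (G (y + h) ω - G y ω)
      = (((G (x + h) ω - G y ω) ^ 2 + (G x ω - G (y + h) ω) ^ 2)
        - ((G (x + h) ω - G (y + h) ω) ^ 2 + (G x ω - G y ω) ^ 2)) / 2 := fun ω ↦ by ring
  simp only [h1]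
  have hi2 : ∀ u v u' v', Integrable
      (fun ω ↦ (G u ω - G v ω) ^ 2 + (G u' ω - G v' ω) ^ 2) P := fun u v u' v' ↦
    (hi u v).add (hi u' v')
  rw [integral_div, integral_sub (hi2 _ _ _ _) (hi2 _ _ _ _),
    integral_add (hi _ _) (hi _ _), integral_add (hi _ _) (hi _ _)]
  simp only [integral_sub_sq_eq_incrementVar hstat]
  rw [show x + h - y = x - y + h by ring, show x - (y + h) = x - y - h by ring,
    show x + h - (y + h) = x - y by ring]
  ring

theorem IsGaussianProcess.hasGaussianLaw_scaled_increments (hGauss : IsGaussianProcess G P)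
    {N : ℕ} (x : Fin N → ℝ) (h s : ℝ) :
    HasGaussianLaw (fun ω (i : Fin N) ↦ (G (x i + h) ω - G (x i) ω) / s) P := by
  classical
  let L : ((Finset.univ.image x ∪ Finset.univ.image (fun i ↦ x i + h) : Finset ℝ) → ℝ) →L[ℝ]
      Fin N → ℝ :=
    { toFun v i := (v ⟨x i + h, by simp⟩ - v ⟨x i, by simp⟩) / s
      map_add' v w := by ext; simp; ring
      map_smul' c v := by ext; simp; ring }
  exact (hGauss.hasGaussianLaw _).map L

/-- Deviation inequality for the discretised `L^p` norm of the increments. -/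
theorem measureReal_grid_deviation_le (hGauss : IsGaussianProcess G P)
    (hmean : ∀ x, ∫ ω, G x ω ∂P = 0) (hstat : HasStationaryIncrements G P) {δ : ℝ}
    (hconc : ConcaveOn ℝ (Icc 0 δ) (incrementVar G P))
    (hmono : MonotoneOn (incrementVar G P) (Icc 0 δ))
    (hne : ∃ h ∈ Icc 0 δ, incrementVar G P h ≠ 0) {p : ℝ} (hp : 1 ≤ p) (a : ℝ) {L h τ : ℝ}
    (hL : 0 < L) (hh : 0 < h) (hδ : L + 3 * h ≤ δ) (hτ : 0 ≤ τ) {N : ℕ} (hN : 0 < N)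
    (hNh : L / N ≤ h) :
    P.real {ω | p * (2 * Real.exp (Real.pi ^ 2 / 8)) ^ p⁻¹ * √((6 * h / L) ^ p⁻¹) + τ ≤
        |smoothLpNorm (fun _ : Fin N ↦ 1 / (N : ℝ)) p 0 (fun i ↦
          (G (a + i * (L / N) + h) ω - G (a + i * (L / N)) ω) / incrementStd G P h)
          - (∫ y, |y| ^ p ∂(gaussianReal 0 1)) ^ p⁻¹|}
      ≤ 2 * Real.exp (-τ ^ 2 / (4 * (Real.pi ^ 2 / 8 * (6 * h / L) ^ p⁻¹))) := by
  have hN0 : (0 : ℝ) < N := Nat.cast_pos.2 hN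
  set φ := incrementVar G P with hφ
  set κ := L / N with hκ
  have hκ0 : 0 < κ := by positivity
  have hNκ : N * κ = L := by rw [hκ]; field_simp
  have hφh : 0 < φ h := hconc.pos_of_ne_zero hmono incrementVar_zero hne hh (by linarith)
  have hσ : incrementStd G P h ^ 2 = φ h := Real.sq_sqrt hφh.le
  have hσ0 : 0 < incrementStd G P h := Real.sqrt_pos.2 hφh
  set X : Ω → Fin N → ℝ := fun ω i ↦
    (G (a + i * κ + h) ω - G (a + i * κ) ω) / incrementStd G P h with hX
  have hlaw : HasGaussianLaw X P :=
    IsGaussianProcess.hasGaussianLaw_scaled_increments hGauss (fun i : Fin N ↦ a + i * κ) h _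
  have hXm : AEMeasurable X P := hlaw.aemeasurable
  set μ := P.map X with hμ
  have : IsGaussian μ := hlaw.isGaussian_map
  have hGi : ∀ u, Integrable (G u) P := fun u ↦ (hGauss.hasGaussianLaw_eval u).integrable
  have hcov : ∀ i j : Fin N, ∫ x, x i * x j ∂μ = (φ (((i : ℝ) - j) * κ + h)
      + φ (((i : ℝ) - j) * κ - h) - 2 * φ (((i : ℝ) - j) * κ)) / (2 * φ h) := by
    intro i j
    rw [hμ, integral_map hXm (by fun_prop)]
    have h1 : ∀ ω, X ω i * X ω j = ((G (a + i * κ + h) ω - G (a + i * κ) ω) *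
        (G (a + j * κ + h) ω - G (a + j * κ) ω)) / φ h := by
      intro ω
      rw [← hσ]
      simp only [hX]
      field_simp
    simp only [h1]
    rw [integral_div, integral_increment_mul_increment hGauss hstat,
      show a + i * κ - (a + j * κ) = ((i : ℝ) - j) * κ by ring, div_div]
  have hcent : ∀ i : Fin N, ∫ x, x i ∂μ = 0 := by
    intro i
    rw [hμ, integral_map hXm (measurable_pi_apply i).aestronglyMeasurable]
    simp only [hX]
    rw [integral_div, integral_sub (hGi _) (hGi _), hmean, hmean]
    simp
  have hneg : ∀ s, φ (-s) = φ s := incrementVar_neg hstat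
  have hvar : ∀ i : Fin N, ∫ x, x i ^ 2 ∂μ = 1 := by
    intro i
    simp only [sq]
    have hφ0 : φ 0 = 0 := incrementVar_zero
    rw [hcov, sub_self, zero_mul, zero_add, zero_sub, hneg, hφ0]
    field_simp
    ring
  have hr : ∀ i : Fin N, ∑ j : Fin N, 1 / (N : ℝ) * |∫ x, x i * x j ∂μ| ≤ 6 * h / L := by
    intro i
    set ρ : ℤ → ℝ := fun k ↦ |φ (k * κ + h) + φ (k * κ - h) - 2 * φ (k * κ)| with hρ
    have hρneg : ∀ k, ρ (-k) = ρ k := by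
      intro k
      simp only [hρ]
      push_cast
      rw [show -(k : ℝ) * κ + h = -(k * κ - h) by ring,
        show -(k : ℝ) * κ - h = -(k * κ + h) by ring, neg_mul, hneg, hneg, hneg]
      congr 1
      ring
    have h1 : ∀ j : Fin N, 1 / (N : ℝ) * |∫ x, x i * x j ∂μ|
        = 1 / (N * (2 * φ h)) * ρ (((i : ℕ) : ℤ) - ((j : ℕ) : ℤ)) := by
      intro j
      rw [hcov, abs_div, abs_of_pos (by positivity : 0 < 2 * φ h)]
      simp only [hρ]
      push_cast
      field_simp
    rw [Finset.sum_congr rfl fun j _ ↦ h1 j, ← Finset.mul_sum,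
      Fin.sum_univ_eq_sum_range (fun j : ℕ ↦ ρ (((i : ℕ) : ℤ) - (j : ℤ))) N]
    have h2 := sum_range_abs_sub_le (ρ := ρ) (fun k ↦ abs_nonneg _) hρneg i.2
    have h3 := sum_range_abs_second_difference_le hconc hmono incrementVar_zero hneg hκ0 hNh
      hNκ.le hL.le hδ
    have h4 : ∑ k ∈ Finset.range N, ρ k ≤ 6 * (h / κ) * φ h := by
      simpa only [hρ, Int.cast_natCast] using h3
    calc _ ≤ 1 / (N * (2 * φ h)) * (2 * (6 * (h / κ) * φ h)) :=
          mul_le_mul_of_nonneg_left (by linarith) (by positivity)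
      _ = 6 * h / (N * κ) := by field_simp
      _ = _ := by rw [hNκ]
  have hw1 : ∑ _i : Fin N, 1 / (N : ℝ) = 1 := by
    simp [hN0.ne']
  have key := measureReal_smoothLpNorm_deviation_le μ hcent hvar hp
    (w := fun _ : Fin N ↦ 1 / (N : ℝ)) (fun _ ↦ by positivity) hw1
    (by positivity : 0 < 6 * h / L) hr hτ
  have hcontN := continuous_smoothLpNorm_right (fun _ : Fin N ↦ 1 / (N : ℝ))
    (by linarith : 0 < p) 0
  have hmeas : MeasurableSet {x : Fin N → ℝ |
      p * (2 * Real.exp (Real.pi ^ 2 / 8)) ^ p⁻¹ * √((6 * h / L) ^ p⁻¹) + τ ≤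
        |smoothLpNorm (fun _ : Fin N ↦ 1 / (N : ℝ)) p 0 x
          - (∫ y, |y| ^ p ∂(gaussianReal 0 1)) ^ p⁻¹|} :=
    (isClosed_le continuous_const ((hcontN.sub continuous_const).abs)).measurableSet
  rw [measureReal_def, hμ, Measure.map_apply_of_aemeasurable hXm hmeas] at key
  exact key

variable [IsProbabilityMeasure P]

/-- Deviation inequality for the normalised `L^p` norm of the increments along a path. -/
theorem measureReal_lpIncrement_deviation_le (hGauss : IsGaussianProcess G P)
    (hmean : ∀ x, ∫ ω, G x ω ∂P = 0) (hstat : HasStationaryIncrements G P)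
    (hcont : ∀ᵐ ω ∂P, Continuous fun x ↦ G x ω) {δ : ℝ}
    (hconc : ConcaveOn ℝ (Icc 0 δ) (incrementVar G P))
    (hmono : MonotoneOn (incrementVar G P) (Icc 0 δ))
    (hne : ∃ h ∈ Icc 0 δ, incrementVar G P h ≠ 0) {p : ℝ} (hp : 1 ≤ p) (a : ℝ) {L h τ : ℝ}
    (hL : 0 < L) (hh : 0 < h) (hδ : L + 3 * h ≤ δ) (hτ : 0 ≤ τ) :
    P.real {ω | p * (2 * Real.exp (Real.pi ^ 2 / 8)) ^ p⁻¹ * √((6 * h / L) ^ p⁻¹) + τ <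
        |((1 / L) * lpIncrement G P p a (a + L) h ω) ^ p⁻¹
          - (∫ y, |y| ^ p ∂(gaussianReal 0 1)) ^ p⁻¹|}
      ≤ 2 * Real.exp (-τ ^ 2 / (4 * (Real.pi ^ 2 / 8 * (6 * h / L) ^ p⁻¹))) := by
  have hp0 : 0 < p := by linarith
  set c := (∫ y, |y| ^ p ∂(gaussianReal 0 1)) ^ p⁻¹
  set B := p * (2 * Real.exp (Real.pi ^ 2 / 8)) ^ p⁻¹ * √((6 * h / L) ^ p⁻¹) + τ
  set Fn : ℕ → Ω → ℝ := fun N ω ↦ smoothLpNorm (fun _ : Fin N ↦ 1 / (N : ℝ)) p 0 (fun i ↦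
    (G (a + i * (L / N) + h) ω - G (a + i * (L / N)) ω) / incrementStd G P h) with hFn
  -- Beyond `N₀` the mesh is at most `h`, as the grid estimate requires.
  obtain ⟨N₀, hN₀⟩ := exists_nat_gt (L / h)
  have hgrid : ∀ n : ℕ, P.real {ω | B ≤ |Fn (n + N₀ + 1) ω - c|}
      ≤ 2 * Real.exp (-τ ^ 2 / (4 * (Real.pi ^ 2 / 8 * (6 * h / L) ^ p⁻¹))) := by
    intro n
    refine measureReal_grid_deviation_le hGauss hmean hstat hconc hmono hne hp a hL hh hδ hτ
      (Nat.succ_pos _) ?_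
    rw [div_lt_iff₀ hh] at hN₀
    rw [div_le_iff₀ (by positivity)]
    push_cast
    have : (0 : ℝ) ≤ n := Nat.cast_nonneg n
    nlinarith
  have hlim : ∀ ω, Continuous (fun x ↦ G x ω) → Tendsto (fun N ↦ Fn N ω) atTop
      (𝓝 (((1 / L) * lpIncrement G P p a (a + L) h ω) ^ p⁻¹)) := by
    intro ω hω
    have hf : Continuous fun x ↦ |(G (x + h) ω - G x ω) / incrementStd G P h| ^ p :=
      Continuous.rpow_const (((hω.comp (continuous_id.add continuous_const)).sub hω).div_const
        _).abs fun _ ↦ Or.inr hp0.le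
    have h1 := (tendsto_riemann_sum hf a hL).rpow_const (p := p⁻¹) (Or.inr (by positivity))
    refine h1.congr fun N ↦ ?_
    simp only [hFn, smoothLpNorm, smoothPowSum_zero]
    rw [Fin.sum_univ_eq_sum_range (fun i : ℕ ↦ 1 / (N : ℝ) * |(G (a + i * (L / N) + h) ω
      - G (a + i * (L / N)) ω) / incrementStd G P h| ^ p) N]
  -- A strict deviation of the limit forces the weak one for all fine grids, hence membership in
  -- some `S k`; the `S k` increase and obey the grid bound uniformly.
  set S : ℕ → Set Ω := fun k ↦ ⋂ n ∈ Ici k, {ω | B ≤ |Fn (n + N₀ + 1) ω - c|} with hS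
  have hSmono : Monotone S := fun k l hkl ↦
    biInter_subset_biInter_left (Ici_subset_Ici.2 hkl)
  have hsub : ∀ᵐ ω ∂P, ω ∈ {ω | B < |((1 / L) * lpIncrement G P p a (a + L) h ω) ^ p⁻¹ - c|} →
      ω ∈ ⋃ k, S k := by
    filter_upwards [hcont] with ω hω hB
    have h1 := (((hlim ω hω).comp (tendsto_add_atTop_nat (N₀ + 1))).sub_const c).abs
    have h2 := h1.eventually_const_le hB
    obtain ⟨k, hk⟩ := eventually_atTop.1 h2
    exact mem_iUnion.2 ⟨k, mem_iInter₂.2 fun n hn ↦ hk n hn⟩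
  have hle : P (⋃ k, S k)
      ≤ ENNReal.ofReal (2 * Real.exp (-τ ^ 2 / (4 * (Real.pi ^ 2 / 8 * (6 * h / L) ^ p⁻¹)))) := by
    rw [hSmono.measure_iUnion]
    refine iSup_le fun k ↦ (measure_mono (biInter_subset_of_mem (mem_Ici.2 le_rfl))).trans ?_
    rw [← ofReal_measureReal]
    exact ENNReal.ofReal_le_ofReal (hgrid k)
  exact ENNReal.toReal_le_of_le_ofReal (by positivity) ((measure_mono_ae hsub).trans hle)

end Increments

/-! ### Almost sure convergence along the scales `h_n` -/

section BorelCantelli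

theorem tendsto_one_div_log_rpow {q : ℝ} (hq : 0 < q) {hn : ℕ → ℝ}
    (hhn : ∀ n : ℕ, 2 ≤ n → hn n = 1 / (Real.log n) ^ q) : Tendsto hn atTop (𝓝 0) := by
  have h1 : Tendsto (fun n : ℕ ↦ 1 / (Real.log n) ^ q) atTop (𝓝 0) :=
    ((tendsto_rpow_atTop hq).comp
      (Real.tendsto_log_atTop.comp tendsto_natCast_atTop_atTop)).const_div_atTop 1
  refine h1.congr' ?_
  filter_upwards [eventually_ge_atTop 2] with n hn2 using (hhn n hn2).symm

theorem one_div_log_rpow_pos {q : ℝ} {hn : ℕ → ℝ}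
    (hhn : ∀ n : ℕ, 2 ≤ n → hn n = 1 / (Real.log n) ^ q) {n : ℕ} (h2 : 2 ≤ n) : 0 < hn n := by
  have : 0 < Real.log n := Real.log_pos (by exact_mod_cast h2)
  rw [hhn n h2]
  positivity

/-- The exponent is a negative multiple of `(log n)^{q/p}`; as `q / p > 1` it eventually drops below
`-2 log n`, giving a comparison with `1/n²`. -/
theorem summable_exp_neg_div_rpow {p q A B : ℝ} (hp : 0 < p) (hpq : p < q) (hA : 0 < A)
    (hB : 0 < B) {hn : ℕ → ℝ} (hhn : ∀ n : ℕ, 2 ≤ n → hn n = 1 / (Real.log n) ^ q) :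
    Summable fun n ↦ Real.exp (-A / (B * hn n) ^ p⁻¹) := by
  have hα : 0 < q / p - 1 := by
    rw [sub_pos, one_lt_div hp]
    exact hpq
  have hlog : Tendsto (fun n : ℕ ↦ Real.log n) atTop atTop :=
    Real.tendsto_log_atTop.comp tendsto_natCast_atTop_atTop
  have h1 : Tendsto (fun n : ℕ ↦ A / B ^ p⁻¹ * (Real.log n) ^ (q / p - 1)) atTop atTop :=
    ((tendsto_rpow_atTop hα).comp hlog).const_mul_atTop (by positivity)
  refine Summable.of_norm_bounded_eventually_nat (g := fun n : ℕ ↦ 1 / (n : ℝ) ^ 2)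
    (Real.summable_one_div_nat_pow.2 one_lt_two) ?_
  filter_upwards [h1.eventually_ge_atTop 2, eventually_ge_atTop 2] with n hn1 hn2
  have hn0 : (0 : ℝ) < n := by
    have : 0 < n := by omega
    exact_mod_cast this
  have hl : 0 < Real.log n := Real.log_pos (by exact_mod_cast hn2)
  rw [Real.norm_of_nonneg (Real.exp_pos _).le]
  have h2 : (B * hn n) ^ p⁻¹ = B ^ p⁻¹ / (Real.log n) ^ (q / p) := by
    rw [hhn n hn2, mul_one_div, Real.div_rpow hB.le (by positivity), ← Real.rpow_mul hl.le,
      div_eq_mul_inv q p]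
  have h3 : A / B ^ p⁻¹ * (Real.log n) ^ (q / p) = A / B ^ p⁻¹ * (Real.log n) ^ (q / p - 1)
      * Real.log n := by
    rw [Real.rpow_sub hl, Real.rpow_one]
    field_simp
  have h4 : -A / (B * hn n) ^ p⁻¹ = -(A / B ^ p⁻¹ * (Real.log n) ^ (q / p)) := by
    rw [h2]
    field_simp
  rw [h4, h3, one_div, ← Real.exp_log (by positivity : 0 < ((n : ℝ) ^ 2)⁻¹), Real.exp_le_exp,
    Real.log_inv, Real.log_pow]
  push_cast
  nlinarith

variable {Ω : Type*} [MeasurableSpace Ω] {P : Measure Ω} {G : ℝ → Ω → ℝ}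

theorem lpIncrement_nonneg {p a b h : ℝ} (hab : a ≤ b) (ω : Ω) :
    0 ≤ lpIncrement G P p a b h ω :=
  intervalIntegral.integral_nonneg hab fun _ _ ↦ by positivity

variable [IsProbabilityMeasure P]

theorem ae_tendsto_lpIncrement_short (hGauss : IsGaussianProcess G P)
    (hmean : ∀ x, ∫ ω, G x ω ∂P = 0) (hstat : HasStationaryIncrements G P)
    (hcont : ∀ᵐ ω ∂P, Continuous fun x ↦ G x ω) {δ : ℝ}
    (hconc : ConcaveOn ℝ (Icc 0 δ) (incrementVar G P))
    (hmono : MonotoneOn (incrementVar G P) (Icc 0 δ))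
    (hne : ∃ h ∈ Icc 0 δ, incrementVar G P h ≠ 0) {p q : ℝ} (hp : 1 ≤ p) (hpq : p < q)
    {hn : ℕ → ℝ} (hhn : ∀ n : ℕ, 2 ≤ n → hn n = 1 / (Real.log n) ^ q) (a : ℝ) {L : ℝ}
    (hL : 0 < L) (hLδ : L < δ) :
    ∀ᵐ ω ∂P, Tendsto (fun n ↦ lpIncrement G P p a (a + L) (hn n) ω) atTop
      (𝓝 ((∫ y, |y| ^ p ∂(gaussianReal 0 1)) * L)) := by
  have hp0 : 0 < p := by linarith
  set m := ∫ y, |y| ^ p ∂(gaussianReal 0 1) with hm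
  have hm0 : 0 ≤ m := integral_nonneg fun y ↦ by positivity
  have hn0 := tendsto_one_div_log_rpow (by linarith : 0 < q) hhn
  have hpos : ∀ᶠ n in atTop, 0 < hn n := by
    filter_upwards [eventually_ge_atTop 2] with n h2 using one_div_log_rpow_pos hhn h2
  set B : ℕ → ℝ := fun n ↦
    p * (2 * Real.exp (Real.pi ^ 2 / 8)) ^ p⁻¹ * √((6 * hn n / L) ^ p⁻¹) with hB
  have hB0 : Tendsto B atTop (𝓝 0) := by
    have h1 : Tendsto (fun n ↦ √((6 * hn n / L) ^ p⁻¹)) atTop (𝓝 0) := by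
      have h2 := (((hn0.const_mul 6).div_const L).rpow_const (p := p⁻¹)
        (Or.inr (by positivity))).sqrt
      simpa [Real.zero_rpow (inv_ne_zero hp0.ne')] using h2
    simpa [hB] using h1.const_mul (p * (2 * Real.exp (Real.pi ^ 2 / 8)) ^ p⁻¹)
  have hdev : ∀ k : ℕ, ∀ᵐ ω ∂P, ∀ᶠ n in atTop,
      |((1 / L) * lpIncrement G P p a (a + L) (hn n) ω) ^ p⁻¹ - m ^ p⁻¹|
        ≤ B n + 1 / ((k : ℝ) + 1) := by
    intro k
    set τ : ℝ := 1 / ((k : ℝ) + 1) with hτ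
    have hτ0 : 0 < τ := by positivity
    -- The strict inequality `L < δ` leaves room for the margin `3 * hn n`.
    have hev : ∀ᶠ n in atTop, 0 < hn n ∧ L + 3 * hn n ≤ δ := by
      have h1 := (hn0.const_mul 3).const_add L
      rw [mul_zero, add_zero] at h1
      filter_upwards [hpos, h1.eventually_le_const hLδ] with n h2 h3 using ⟨h2, h3⟩
    obtain ⟨n₀, hn₀⟩ := eventually_atTop.1 hev
    set s : ℕ → Set Ω := fun n ↦ {ω | B n + τ <
      |((1 / L) * lpIncrement G P p a (a + L) (hn n) ω) ^ p⁻¹ - m ^ p⁻¹|} with hs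
    have hsum : Summable fun n ↦ 2 * Real.exp
        (-(τ ^ 2 / (4 * (Real.pi ^ 2 / 8))) / (6 / L * hn n) ^ p⁻¹) :=
      (summable_exp_neg_div_rpow hp0 hpq (by positivity) (by positivity) hhn).mul_left 2
    have hsum' := (summable_nat_add_iff n₀).2 hsum
    have hmeas : ∑' n, P (s (n + n₀)) ≠ ⊤ := by
      refine ne_top_of_le_ne_top hsum'.tsum_ofReal_ne_top (ENNReal.tsum_le_tsum fun n ↦ ?_)
      obtain ⟨h1, h2⟩ := hn₀ (n + n₀) (Nat.le_add_left _ _)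
      have h3 := measureReal_lpIncrement_deviation_le hGauss hmean hstat hcont hconc hmono hne hp a
        hL h1 h2 hτ0.le
      rw [← ofReal_measureReal]
      refine ENNReal.ofReal_le_ofReal (h3.trans_eq ?_)
      have h4 : 6 * hn (n + n₀) / L = 6 / L * hn (n + n₀) := by ring
      rw [h4]
      congr 2
      have h5 : 0 < (6 / L * hn (n + n₀)) ^ p⁻¹ := by positivity
      field_simp
    filter_upwards [ae_eventually_notMem hmeas] with ω hω
    rw [← map_add_atTop_eq_nat n₀, eventually_map]
    filter_upwards [hω] with n hnω
    exact not_lt.1 hnω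
  filter_upwards [ae_all_iff.2 hdev] with ω hω
  have hF : Tendsto (fun n ↦ ((1 / L) * lpIncrement G P p a (a + L) (hn n) ω) ^ p⁻¹) atTop
      (𝓝 (m ^ p⁻¹)) := by
    rw [Metric.tendsto_atTop']
    intro ε hε
    obtain ⟨k, hk⟩ := exists_nat_one_div_lt (half_pos hε)
    have h1 : ∀ᶠ n in atTop, B n < ε / 2 := hB0.eventually_lt_const (half_pos hε)
    obtain ⟨n₁, hn₁⟩ := eventually_atTop.1 ((hω k).and h1)
    refine ⟨n₁, fun n hnn ↦ ?_⟩
    obtain ⟨h2, h3⟩ := hn₁ n hnn.le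
    rw [Real.dist_eq]
    linarith
  have hnn : ∀ n, 0 ≤ (1 / L) * lpIncrement G P p a (a + L) (hn n) ω := fun n ↦
    mul_nonneg (by positivity) (lpIncrement_nonneg (by linarith) ω)
  have h1 := ((hF.rpow_const (p := p) (Or.inr hp0.le))).mul_const L
  rw [← Real.rpow_mul hm0, inv_mul_cancel₀ hp0.ne', Real.rpow_one] at h1
  refine h1.congr fun n ↦ ?_
  rw [← Real.rpow_mul (hnn n), inv_mul_cancel₀ hp0.ne', Real.rpow_one]
  field_simp

theorem continuous_increment_rpow {g : ℝ → ℝ} (hg : Continuous g) {p : ℝ} (hp : 0 ≤ p)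
    (h s : ℝ) : Continuous fun x ↦ |(g (x + h) - g x) / s| ^ p :=
  Continuous.rpow_const (((hg.comp (continuous_id.add continuous_const)).sub hg).div_const
    _).abs fun _ ↦ Or.inr hp

/-- Concavity is available only up to `δ`, so the interval is cut into finitely many pieces shorter
than `δ` and the limits are added. -/
theorem ae_tendsto_lpIncrement_seq (hGauss : IsGaussianProcess G P)
    (hmean : ∀ x, ∫ ω, G x ω ∂P = 0) (hstat : HasStationaryIncrements G P)
    (hcont : ∀ᵐ ω ∂P, Continuous fun x ↦ G x ω) {δ : ℝ} (hδ : 0 < δ)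
    (hconc : ConcaveOn ℝ (Icc 0 δ) (incrementVar G P))
    (hmono : MonotoneOn (incrementVar G P) (Icc 0 δ))
    (hne : ∃ h ∈ Icc 0 δ, incrementVar G P h ≠ 0) {p q : ℝ} (hp : 1 ≤ p) (hpq : p < q)
    {hn : ℕ → ℝ} (hhn : ∀ n : ℕ, 2 ≤ n → hn n = 1 / (Real.log n) ^ q) {a b : ℝ} (hab : a < b) :
    ∀ᵐ ω ∂P, Tendsto (fun n ↦ lpIncrement G P p a b (hn n) ω) atTop
      (𝓝 ((∫ y, |y| ^ p ∂(gaussianReal 0 1)) * (b - a))) := by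
  obtain ⟨N, hN⟩ := exists_nat_gt ((b - a) / δ)
  have hN0 : (0 : ℝ) < N := (div_pos (sub_pos.2 hab) hδ).trans hN
  set L := (b - a) / N with hLdef
  have hL : 0 < L := div_pos (sub_pos.2 hab) hN0
  have hLδ : L < δ := by
    rw [hLdef, div_lt_iff₀ hN0]
    rw [div_lt_iff₀ hδ] at hN
    linarith
  have hNL : N * L = b - a := by rw [hLdef]; field_simp
  have h1 := ae_all_iff.2 fun i : ℕ ↦ ae_tendsto_lpIncrement_short hGauss hmean hstat hcont hconc
    hmono hne hp hpq hhn (a + i * L) hL hLδ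
  filter_upwards [h1, hcont] with ω hω hωc
  have h2 := tendsto_finsetSum (Finset.range N) fun i _ ↦ hω i
  rw [Finset.sum_const, Finset.card_range, nsmul_eq_mul,
    mul_left_comm, hNL] at h2
  refine h2.congr fun n ↦ ?_
  have h3 := intervalIntegral.sum_integral_adjacent_intervals (μ := volume)
    (f := fun x ↦ |(G (x + hn n) ω - G x ω) / incrementStd G P (hn n)| ^ p)
    (a := fun i : ℕ ↦ a + i * L) (n := N) fun k _ ↦
      (continuous_increment_rpow hωc (by linarith) _ _).intervalIntegrable _ _
  simp only [Nat.cast_zero, zero_mul, add_zero, hNL, add_sub_cancel] at h3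
  rw [lpIncrement, ← h3]
  refine Finset.sum_congr rfl fun i _ ↦ ?_
  rw [lpIncrement]
  congr 1
  push_cast
  ring

end BorelCantelli

/-! ### From the sequence `h_n` to all small scales, along a continuous path -/

section Interpolation

/-- Minkowski's inequality for continuous functions on an interval. -/
theorem rpow_integral_abs_add_le {f₁ f₂ : ℝ → ℝ} (h₁ : Continuous f₁) (h₂ : Continuous f₂)
    {p : ℝ} (hp : 1 ≤ p) {c d : ℝ} (hcd : c ≤ d) :
    (∫ x in c..d, |f₁ x + f₂ x| ^ p) ^ p⁻¹
      ≤ (∫ x in c..d, |f₁ x| ^ p) ^ p⁻¹ + (∫ x in c..d, |f₂ x| ^ p) ^ p⁻¹ := by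
  have hp0 : 0 < p := by linarith
  have hpne : ENNReal.ofReal p ≠ 0 := by simpa using hp0
  have hptop : ENNReal.ofReal p ≠ ⊤ := ENNReal.ofReal_ne_top
  have hp1 : 1 ≤ ENNReal.ofReal p := by simpa using hp
  have hptr : (ENNReal.ofReal p).toReal = p := ENNReal.toReal_ofReal hp0.le
  have hn : ∀ {f : ℝ → ℝ}, Continuous f →
      lpNorm f (ENNReal.ofReal p) (volume.restrict (Ioc c d)) = (∫ x in c..d, |f x| ^ p) ^ p⁻¹ := by
    intro f hf
    rw [lpNorm_eq_integral_norm_rpow_toReal hpne hptop hf.aestronglyMeasurable, hptr,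
      intervalIntegral.integral_of_le hcd]
    simp only [Real.norm_eq_abs]
  have hmem : MemLp f₁ (ENNReal.ofReal p) (volume.restrict (Ioc c d)) := by
    rw [← integrable_norm_rpow_iff h₁.aestronglyMeasurable hpne hptop, hptr]
    exact ((h₁.norm.rpow_const fun _ ↦ Or.inr hp0.le).integrableOn_Ioc)
  have h := lpNorm_add_le (g := f₂) hmem hp1
  rw [hn h₁, hn h₂, hn (h₁.add h₂)] at h
  exact h

/-- The `L^p` norm of the increment `x ↦ g (x + u) - g x` over `[c, d]`. -/
noncomputable def incrementNorm (g : ℝ → ℝ) (p c d u : ℝ) : ℝ :=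
  (∫ x in c..d, |g (x + u) - g x| ^ p) ^ p⁻¹

variable {g : ℝ → ℝ} {p : ℝ}

theorem continuous_abs_increment_rpow (hg : Continuous g) (hp : 0 ≤ p) (u : ℝ) :
    Continuous fun x ↦ |g (x + u) - g x| ^ p :=
  ((hg.comp (continuous_id.add continuous_const)).sub hg).abs.rpow_const fun _ ↦ Or.inr hp

theorem incrementNorm_nonneg {c d : ℝ} (hcd : c ≤ d) (u : ℝ) : 0 ≤ incrementNorm g p c d u :=
  Real.rpow_nonneg (intervalIntegral.integral_nonneg hcd fun _ _ ↦ by positivity) _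

theorem incrementNorm_zero (hp : 0 < p) (c d : ℝ) : incrementNorm g p c d 0 = 0 := by
  simp [incrementNorm, Real.zero_rpow hp.ne', Real.zero_rpow (inv_ne_zero hp.ne')]

theorem incrementNorm_mono_interval (hg : Continuous g) (hp : 0 < p) {A B c d : ℝ} (hAc : A ≤ c)
    (hcd : c ≤ d) (hdB : d ≤ B) (u : ℝ) : incrementNorm g p c d u ≤ incrementNorm g p A B u := by
  refine Real.rpow_le_rpow (intervalIntegral.integral_nonneg hcd fun _ _ ↦ by positivity) ?_
    (by positivity)
  exact intervalIntegral.integral_mono_interval hAc hcd hdB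
    (ae_of_all _ fun x ↦ by positivity)
    ((continuous_abs_increment_rpow hg hp.le u).intervalIntegrable _ _)

theorem incrementNorm_shift (c d u v : ℝ) :
    incrementNorm g p (c + u) (d + u) v
      = (∫ x in c..d, |g (x + u + v) - g (x + u)| ^ p) ^ p⁻¹ := by
  rw [incrementNorm, intervalIntegral.integral_comp_add_right (fun x ↦ |g (x + v) - g x| ^ p) u]

theorem incrementNorm_add_le (hg : Continuous g) (hp : 1 ≤ p) {c d : ℝ} (hcd : c ≤ d) (u v : ℝ) :
    incrementNorm g p c d (u + v)
      ≤ incrementNorm g p c d u + incrementNorm g p (c + u) (d + u) v := by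
  have h := rpow_integral_abs_add_le (f₁ := fun x ↦ g (x + u) - g x)
    (f₂ := fun x ↦ g (x + u + v) - g (x + u)) (by fun_prop) (by fun_prop) hp hcd
  rw [incrementNorm_shift]
  refine le_trans (le_of_eq ?_) h
  simp only [incrementNorm, ← add_assoc]
  congr 2
  ext x
  congr 2
  ring

theorem incrementNorm_le_add (hg : Continuous g) (hp : 1 ≤ p) {c d : ℝ} (hcd : c ≤ d) (u v : ℝ) :
    incrementNorm g p c d u
      ≤ incrementNorm g p c d (u + v) + incrementNorm g p (c + u) (d + u) v := by
  have h := rpow_integral_abs_add_le (f₁ := fun x ↦ g (x + (u + v)) - g x)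
    (f₂ := fun x ↦ g (x + u) - g (x + u + v)) (by fun_prop) (by fun_prop) hp hcd
  rw [incrementNorm_shift]
  simp only [abs_sub_comm (g (_ + u + v))]
  refine le_trans (le_of_eq ?_) h
  simp only [incrementNorm, ← add_assoc]
  congr 2
  ext x
  congr 2
  ring

theorem tendsto_incrementNorm_zero (hg : Continuous g) (hp : 0 < p) (c d : ℝ) :
    Tendsto (incrementNorm g p c d) (𝓝 0) (𝓝 0) := by
  have h1 : Continuous fun u ↦ ∫ x in c..d, |g (x + u) - g x| ^ p := by
    refine intervalIntegral.continuous_parametric_intervalIntegral_of_continuous' ?_ c d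
    simp only [Function.uncurry_def]
    exact Continuous.rpow_const (by fun_prop) fun _ ↦ Or.inr hp.le
  have h2 : Continuous (incrementNorm g p c d) :=
    h1.rpow_const fun _ ↦ Or.inr (by positivity)
  simpa [incrementNorm_zero hp] using h2.tendsto 0

/-- If `g` has increments of size `C σ(hₙ)` at the scales `hₙ` and these scales are dense enough,
then all small increments are of size `2 C σ`. -/
theorem incrementNorm_le_of_seq (hg : Continuous g) (hp : 1 ≤ p) {σ : ℝ → ℝ} {δ : ℝ}
    (hσm : MonotoneOn σ (Icc 0 δ)) (hσpos : ∀ u, 0 < u → u ≤ δ → 0 < σ u) {A B C : ℝ}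
    (hC : 0 ≤ C) {h : ℕ → ℝ} {M : ℕ} (hpos : ∀ n ≥ M, 0 < h n) (hδ : ∀ n ≥ M, h n ≤ δ)
    (hlim : Tendsto h atTop (𝓝 0))
    (hN : ∀ n ≥ M, incrementNorm g p A B (h n) ≤ C * σ (h n))
    (hhalf : ∀ n ≥ M, σ (h n - h (n + 1)) ≤ σ (h (n + 1)) / 2)
    {u c d : ℝ} (hu : 0 < u) (huM : u ≤ h M) (hAc : A ≤ c) (hcd : c ≤ d) (hdB : d + u ≤ B) :
    incrementNorm g p c d u ≤ 2 * C * σ u := by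
  have hp0 : 0 < p := by linarith
  -- The slack `ε` starts the downward induction at a scale so fine that the `L^p` increment is
  -- below `ε` by continuity. It is passed on unchanged at each step, so it does not accumulate.
  refine le_of_forall_pos_le_add fun ε hε ↦ ?_
  set Q : ℕ → Prop := fun n ↦ ∀ u, 0 < u → u ≤ h n → ∀ c d, A ≤ c → c ≤ d → d + u ≤ B →
    incrementNorm g p c d u ≤ 2 * C * σ u + ε with hQ
  suffices hQM : Q M from hQM u hu huM c d hAc hcd hdB
  obtain ⟨η, hη, Hη⟩ := Metric.eventually_nhds_iff.1
    ((tendsto_incrementNorm_zero hg hp0 A B).eventually_le_const hε)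
  obtain ⟨n₁, hn₁M, hn₁⟩ := ((eventually_ge_atTop M).and
    (hlim.eventually_lt_const hη)).exists
  refine Nat.decreasingInduction' (P := Q) (n := n₁) (fun n _ hMn IH ↦ ?_) hn₁M ?_
  · intro u hu hun c d hAc hcd hdB
    rcases le_or_gt u (h (n + 1)) with hle | hlt
    · exact IH u hu hle c d hAc hcd hdB
    have hn1 : n + 1 ≥ M := by omega
    have hp1 := hpos (n + 1) hn1
    have hδn := hδ n hMn
    have hσ1 : 0 < σ (h (n + 1)) := hσpos _ hp1 (hδ _ hn1)
    -- This brings the remainder `u - h (n + 1)` under the induction hypothesis. The `C σ` of the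
    -- main part and half of `2 C σ` from the remainder add up to `2 C σ (h (n + 1))`.
    have hstep : h n - h (n + 1) ≤ h (n + 1) := by
      by_contra hcon
      have h1 : σ (h (n + 1)) ≤ σ (h n - h (n + 1)) :=
        hσm ⟨hp1.le, hδ _ hn1⟩ ⟨by linarith, by linarith⟩ (by linarith)
      linarith [hhalf n hMn]
    have h1 := incrementNorm_add_le hg hp hcd (h (n + 1)) (u - h (n + 1))
    rw [add_sub_cancel] at h1
    have h2 : incrementNorm g p c d (h (n + 1)) ≤ C * σ (h (n + 1)) :=
      (incrementNorm_mono_interval hg hp0 hAc hcd (by linarith) _).trans (hN _ hn1)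
    have h3 := IH (u - h (n + 1)) (by linarith) (by linarith) (c + h (n + 1)) (d + h (n + 1))
      (by linarith) (by linarith) (by linarith)
    have h4 : σ (u - h (n + 1)) ≤ σ (h n - h (n + 1)) :=
      hσm ⟨by linarith, by linarith⟩ ⟨by linarith, by linarith⟩ (by linarith)
    have h5 : σ (h (n + 1)) ≤ σ u := hσm ⟨hp1.le, hδ _ hn1⟩ ⟨hu.le, by linarith⟩ hlt.le
    have h6 := mul_le_mul_of_nonneg_left (h4.trans (hhalf n hMn)) hC
    have h7 := mul_le_mul_of_nonneg_left h5 hC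
    linarith
  · intro u hu hun c d hAc hcd hdB
    have h1 : incrementNorm g p A B u ≤ ε := by
      refine Hη ?_
      rw [Real.dist_eq, sub_zero, abs_of_pos hu]
      linarith
    have h2 : 0 ≤ C * σ u := mul_nonneg hC
      (hσpos u hu (hun.trans (hδ _ hn₁M))).le
    linarith [incrementNorm_mono_interval hg hp0 hAc hcd (by linarith : d ≤ B) u]

theorem tendsto_nhdsGT_of_between {f : ℝ → ℝ} {h lo up : ℕ → ℝ} {ℓ : ℝ} {M : ℕ}
    (hlim : Tendsto h atTop (𝓝 0)) (hpos : ∀ n ≥ M, 0 < h n)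
    (hlo : Tendsto lo atTop (𝓝 ℓ)) (hup : Tendsto up atTop (𝓝 ℓ))
    (hf : ∀ n ≥ M, ∀ u, h (n + 1) ≤ u → u ≤ h n → lo n ≤ f u ∧ f u ≤ up n) :
    Tendsto f (𝓝[>] 0) (𝓝 ℓ) := by
  rw [tendsto_order]
  have key : ∀ R : ℕ → Prop, (∀ᶠ n in atTop, R n) →
      ∀ᶠ u in 𝓝[>] (0 : ℝ), ∃ n ≥ M, R n ∧ h (n + 1) ≤ u ∧ u ≤ h n := by
    intro R hR
    obtain ⟨n₀, hn₀⟩ := eventually_atTop.1 hR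
    set k := max M n₀ with hk
    filter_upwards [Ioo_mem_nhdsGT (hpos k (le_max_left _ _))] with u hu
    -- The scales need not be monotone; the first index after `k` where they fall to `u` or below
    -- yields a bracketing pair.
    have hex : ∃ j, h (k + j + 1) ≤ u := by
      obtain ⟨N, hN1, hN2⟩ := ((hlim.eventually_lt_const hu.1).and
        (eventually_ge_atTop (k + 1))).exists
      exact ⟨N - k - 1, by rw [show k + (N - k - 1) + 1 = N by omega]; exact hN1.le⟩
    classical
    refine ⟨k + Nat.find hex, by omega, hn₀ _ (by omega), Nat.find_spec hex, ?_⟩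
    rcases Nat.eq_zero_or_pos (Nat.find hex) with h0 | h0
    · rw [h0, add_zero]
      exact hu.2.le
    · have h1 := Nat.find_min hex (Nat.sub_one_lt h0.ne')
      rw [show k + (Nat.find hex - 1) + 1 = k + Nat.find hex by omega] at h1
      exact (not_le.1 h1).le
  refine ⟨fun y hy ↦ ?_, fun y hy ↦ ?_⟩
  · filter_upwards [key _ (hlo.eventually_const_lt hy)] with u ⟨n, hnM, h1, h2, h3⟩
    exact h1.trans_le (hf n hnM u h2 h3).1
  · filter_upwards [key _ (hup.eventually_lt_const hy)] with u ⟨n, hnM, h1, h2, h3⟩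
    exact (hf n hnM u h2 h3).2.trans_lt h1

/-- Convergence of the normalised increments along a dense enough sequence of scales implies
convergence over all scales. -/
theorem tendsto_incrementNorm_div (hg : Continuous g) (hp : 1 ≤ p) {σ : ℝ → ℝ} {δ : ℝ}
    (hδ : 0 < δ) (hσm : MonotoneOn σ (Icc 0 δ)) (hσpos : ∀ u, 0 < u → u ≤ δ → 0 < σ u)
    (hσ0 : ∀ u, 0 ≤ σ u)
    (hσsub : ∀ s t, 0 ≤ s → 0 ≤ t → s + t ≤ δ → σ (s + t) ^ 2 ≤ σ s ^ 2 + σ t ^ 2)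
    {h : ℕ → ℝ} (hpos : ∀ᶠ n in atTop, 0 < h n)
    (hlim : Tendsto h atTop (𝓝 0))
    (hreg : Tendsto (fun n ↦ σ (h n - h (n + 1)) / σ (h (n + 1))) atTop (𝓝 0)) {a b ℓ ℓ' : ℝ}
    (hab : a ≤ b) (hℓ : Tendsto (fun n ↦ incrementNorm g p a b (h n) / σ (h n)) atTop (𝓝 ℓ))
    (hℓ' : Tendsto (fun n ↦ incrementNorm g p a (b + 1) (h n) / σ (h n)) atTop (𝓝 ℓ')) :
    Tendsto (fun u ↦ incrementNorm g p a b u / σ u) (𝓝[>] 0) (𝓝 ℓ) := by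
  have hp0 : 0 < p := by linarith
  have hℓ0 : 0 ≤ ℓ := ge_of_tendsto' hℓ fun n ↦
    div_nonneg (incrementNorm_nonneg hab _) (hσ0 _)
  set C := |ℓ'| + 1 with hCdef
  have hC : 0 ≤ C := by positivity
  have hCℓ : ℓ' < C := by linarith [le_abs_self ℓ']
  set τ : ℕ → ℝ := fun n ↦ σ (h n - h (n + 1)) / σ (h (n + 1)) with hτ
  have hev : ∀ᶠ n in atTop, 0 < h n ∧ (h n ≤ δ ∧ h n ≤ 1) ∧
      incrementNorm g p a (b + 1) (h n) / σ (h n) ≤ C ∧ τ n ≤ 1 / 2 :=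
    hpos.and (((hlim.eventually_le_const hδ).and
      (hlim.eventually_le_const one_pos)).and ((hℓ'.eventually_le_const hCℓ).and
      (hreg.eventually_le_const (by norm_num : (0 : ℝ) < 1 / 2))))
  obtain ⟨M, hM⟩ := eventually_atTop.1 hev
  have Hσ : ∀ n ≥ M, 0 < σ (h n) := fun n hn ↦ hσpos _ (hM n hn).1 (hM n hn).2.1.1
  have hτσ : ∀ n ≥ M, σ (h n - h (n + 1)) = τ n * σ (h (n + 1)) := fun n hn ↦
    (div_mul_cancel₀ _ (Hσ (n + 1) (by omega)).ne').symm
  have hx1 : Tendsto (fun n ↦ incrementNorm g p a b (h (n + 1)) / σ (h (n + 1))) atTop (𝓝 ℓ) :=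
    hℓ.comp (tendsto_add_atTop_nat 1)
  have hup : Tendsto (fun n ↦ incrementNorm g p a b (h (n + 1)) / σ (h (n + 1))
      + 2 * C * τ n) atTop (𝓝 ℓ) := by
    simpa using hx1.add (hreg.const_mul (2 * C))
  have hlo : Tendsto (fun n ↦ max 0 (incrementNorm g p a b (h (n + 1)) / σ (h (n + 1))
      - 2 * C * τ n) / √(1 + τ n ^ 2)) atTop (𝓝 ℓ) := by
    have h1 := hx1.sub (hreg.const_mul (2 * C))
    rw [mul_zero, sub_zero] at h1
    have h2 := ((hreg.pow 2).const_add 1).sqrt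
    have h3 := ((tendsto_const_nhds (x := (0 : ℝ))).max h1).div h2 (by simp)
    simpa [max_eq_right hℓ0, Pi.div_def] using h3
  refine tendsto_nhdsGT_of_between (M := M) hlim (fun n hn ↦ (hM n hn).1) hlo hup
    fun n hn u hu1 hu2 ↦ ?_
  have hn1 : n + 1 ≥ M := by omega
  have hp1 := (hM _ hn1).1
  obtain ⟨hpn, ⟨hnδ, hn1'⟩, _, _⟩ := hM n hn
  have hu0 : 0 < u := hp1.trans_le hu1
  have hσ1 := Hσ _ hn1
  have hσu : 0 < σ u := hσpos u hu0 (hu2.trans hnδ)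
  -- The remainder lives on a shifted interval, which is why convergence is also assumed on `[a, b +
  -- 1]`.
  have hbound : incrementNorm g p (a + h (n + 1)) (b + h (n + 1)) (u - h (n + 1))
      ≤ 2 * C * (τ n * σ (h (n + 1))) := by
    rw [← hτσ n hn]
    rcases hu1.eq_or_lt with heq | hlt
    · rw [← heq, sub_self, incrementNorm_zero hp0]
      have := hσ0 (h n - h (n + 1))
      positivity
    have hchain := incrementNorm_le_of_seq hg hp hσm hσpos (A := a) (B := b + 1) (M := n) hC
      (fun k hk ↦ (hM k (by omega)).1) (fun k hk ↦ (hM k (by omega)).2.1.1)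
      hlim
      (fun k hk ↦ (div_le_iff₀ (Hσ k (by omega))).1 (hM k (by omega)).2.2.1)
      (fun k hk ↦ by
        rw [hτσ k (by omega), mul_comm]
        have := mul_le_mul_of_nonneg_left (hM k (by omega)).2.2.2 (Hσ (k + 1) (by omega)).le
        linarith)
      (u := u - h (n + 1)) (c := a + h (n + 1)) (d := b + h (n + 1))
      (by linarith) (by linarith) (by linarith) (by linarith) (by linarith)
    refine hchain.trans (mul_le_mul_of_nonneg_left ?_ (by positivity))
    exact hσm ⟨by linarith, by linarith⟩ ⟨by linarith, by linarith⟩ (by linarith)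
  have t1 := incrementNorm_add_le hg hp hab (h (n + 1)) (u - h (n + 1))
  have t2 := incrementNorm_le_add hg hp hab (h (n + 1)) (u - h (n + 1))
  rw [add_sub_cancel] at t1 t2
  set x := incrementNorm g p a b (h (n + 1)) / σ (h (n + 1)) with hx
  have hxσ : incrementNorm g p a b (h (n + 1)) = x * σ (h (n + 1)) :=
    (div_mul_cancel₀ _ hσ1.ne').symm
  rw [hxσ] at t1 t2
  have hmon : σ (h (n + 1)) ≤ σ u := hσm ⟨hp1.le, by linarith⟩ ⟨hu0.le, by linarith⟩ hu1
  have hτ0 : 0 ≤ τ n := div_nonneg (hσ0 _) (hσ0 _)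
  have hx0 : 0 ≤ x := div_nonneg (incrementNorm_nonneg hab _) (hσ0 _)
  constructor
  · have hs1 : σ u ≤ σ (h (n + 1)) * √(1 + τ n ^ 2) := by
      have h1 : σ u ≤ σ (h n) := hσm ⟨hu0.le, by linarith⟩ ⟨hpn.le, hnδ⟩ hu2
      have h2 := hσsub (h (n + 1)) (h n - h (n + 1)) hp1.le (by linarith) (by linarith)
      rw [add_sub_cancel, hτσ n hn] at h2
      have h3 : σ (h n) ≤ √(σ (h (n + 1)) ^ 2 * (1 + τ n ^ 2)) :=
        Real.le_sqrt_of_sq_le (by linarith)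
      rw [Real.sqrt_mul (sq_nonneg _), Real.sqrt_sq hσ1.le] at h3
      linarith
    -- Truncation at `0` keeps the factor nonnegative, so it may multiply the upper bound on `σ u`.
    have hmax : max 0 (x - 2 * C * τ n) * σ (h (n + 1)) ≤ incrementNorm g p a b u := by
      rw [max_mul_of_nonneg _ _ hσ1.le, zero_mul]
      exact max_le (incrementNorm_nonneg hab _) (by linarith)
    have hmax0 : 0 ≤ max 0 (x - 2 * C * τ n) := le_max_left _ _
    have hsq : 0 < √(1 + τ n ^ 2) := by positivity
    rw [div_le_div_iff₀ hsq hσu]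
    calc _ ≤ max 0 (x - 2 * C * τ n) * (σ (h (n + 1)) * √(1 + τ n ^ 2)) :=
          mul_le_mul_of_nonneg_left hs1 hmax0
      _ = max 0 (x - 2 * C * τ n) * σ (h (n + 1)) * √(1 + τ n ^ 2) := by ring
      _ ≤ _ := mul_le_mul_of_nonneg_right hmax hsq.le
  · rw [div_le_iff₀ hσu]
    have h1 : incrementNorm g p a b u ≤ (x + 2 * C * τ n) * σ (h (n + 1)) := by linarith
    exact h1.trans (mul_le_mul_of_nonneg_left hmon (by positivity))

/-- Monotone functions converging to a linear function at the rationals converge along moving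
points. -/
theorem tendsto_apply_of_tendsto_rat {α : Type*} {l : Filter α} {Φ : α → ℝ → ℝ} {m t : ℝ}
    (hΦ : ∀ x, Monotone (Φ x)) (hrat : ∀ r : ℚ, Tendsto (fun x ↦ Φ x r) l (𝓝 (m * r)))
    {τ : α → ℝ} (hτ : Tendsto τ l (𝓝 t)) : Tendsto (fun x ↦ Φ x (τ x)) l (𝓝 (m * t)) := by
  have hc : Tendsto (fun s : ℝ ↦ m * s) (𝓝 t) (𝓝 (m * t)) := (continuous_const_mul m).tendsto t
  rw [tendsto_order]
  refine ⟨fun y hy ↦ ?_, fun y hy ↦ ?_⟩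
  · obtain ⟨η, hη, H⟩ := Metric.eventually_nhds_iff.1 (hc.eventually_const_lt hy)
    obtain ⟨r, hr1, hr2⟩ := exists_rat_btwn (sub_lt_self t hη)
    have hyr : y < m * r := H (by rw [Real.dist_eq, abs_lt]; constructor <;> linarith)
    filter_upwards [(hrat r).eventually_const_lt hyr, hτ.eventually_const_lt hr2] with x h1 h2
    exact h1.trans_le (hΦ x h2.le)
  · obtain ⟨η, hη, H⟩ := Metric.eventually_nhds_iff.1 (hc.eventually_lt_const hy)
    obtain ⟨r, hr1, hr2⟩ := exists_rat_btwn (lt_add_of_pos_right t hη)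
    have hyr : m * r < y := H (by rw [Real.dist_eq, abs_lt]; constructor <;> linarith)
    filter_upwards [(hrat r).eventually_lt_const hyr, hτ.eventually_lt_const hr1] with x h1 h2
    exact (hΦ x h2.le).trans_lt h1

/-- Two-sided convergence of increment integrals for all endpoints from one-sided convergence for
rational endpoints. -/
theorem tendsto_increment_integral_of_rat (hg : Continuous g) (hp : 0 ≤ p) {σ : ℝ → ℝ}
    (heven : ∀ u, σ (-u) = σ u) {m : ℝ}
    (hrat : ∀ a b : ℚ, a < b → Tendsto
      (fun u ↦ ∫ x in (a : ℝ)..b, |(g (x + u) - g x) / σ u| ^ p) (𝓝[>] 0)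
      (𝓝 (m * ((b : ℝ) - a)))) (a b : ℝ) :
    Tendsto (fun u ↦ ∫ x in a..b, |(g (x + u) - g x) / σ u| ^ p) (𝓝[≠] 0)
      (𝓝 (m * (b - a))) := by
  have hint : ∀ u c d : ℝ, IntervalIntegrable (fun x ↦ |(g (x + u) - g x) / σ u| ^ p)
      volume c d := fun u c d ↦
    (continuous_increment_rpow hg hp u (σ u)).intervalIntegrable _ _
  set Φ : ℝ → ℝ → ℝ := fun u t ↦ ∫ x in (0 : ℝ)..t, |(g (x + u) - g x) / σ u| ^ p with hΦ
  have hsub : ∀ u c d : ℝ, ∫ x in c..d, |(g (x + u) - g x) / σ u| ^ p = Φ u d - Φ u c :=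
    fun u c d ↦ (intervalIntegral.integral_interval_sub_left (hint u 0 d) (hint u 0 c)).symm
  have hmono : ∀ u, Monotone (Φ u) := by
    intro u c d hcd
    have h1 : 0 ≤ ∫ x in c..d, |(g (x + u) - g x) / σ u| ^ p :=
      intervalIntegral.integral_nonneg hcd fun _ _ ↦ by positivity
    rw [hsub] at h1
    linarith
  have hΦrat : ∀ r : ℚ, Tendsto (fun u ↦ Φ u r) (𝓝[>] 0) (𝓝 (m * r)) := by
    intro r
    rcases lt_trichotomy r 0 with hr | hr | hr
    · have h1 := (hrat r 0 hr).neg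
      simp only [Rat.cast_zero] at h1
      simp only [← intervalIntegral.integral_symm] at h1
      simpa using h1
    · simp [hr, hΦ]
    · simpa using hrat 0 r hr
  have hmove : ∀ {τ₁ τ₂ : ℝ → ℝ}, Tendsto τ₁ (𝓝[>] 0) (𝓝 a) → Tendsto τ₂ (𝓝[>] 0) (𝓝 b) →
      Tendsto (fun u ↦ Φ u (τ₂ u) - Φ u (τ₁ u)) (𝓝[>] 0) (𝓝 (m * (b - a))) := by
    intro τ₁ τ₂ h1 h2
    rw [mul_sub]
    exact (tendsto_apply_of_tendsto_rat hmono hΦrat h2).sub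
      (tendsto_apply_of_tendsto_rat hmono hΦrat h1)
  rw [← nhdsLT_sup_nhdsGT, tendsto_sup]
  constructor
  -- Translating by a negative `u` turns the integral over `[a, b]` into one at scale `-u` over `[a
  -- + u, b + u]`, whose endpoints move.
  · have hneg : Tendsto (fun u : ℝ ↦ -u) (𝓝[<] 0) (𝓝[>] 0) := by
      simpa using tendsto_neg_nhdsLT (a := (0 : ℝ))
    have hid : ∀ c : ℝ, Tendsto (fun u : ℝ ↦ c - u) (𝓝[>] 0) (𝓝 c) := fun c ↦
      ((by fun_prop : Continuous fun u : ℝ ↦ c - u).tendsto' 0 c (by simp)).mono_left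
        nhdsWithin_le_nhds
    refine ((hmove (hid a) (hid b)).comp hneg).congr fun u ↦ ?_
    simp only [Function.comp_apply]
    rw [← hsub, sub_neg_eq_add, sub_neg_eq_add,
      ← intervalIntegral.integral_comp_add_right
        (fun x ↦ |(g (x + -u) - g x) / σ (-u)| ^ p) u]
    refine intervalIntegral.integral_congr fun x _ ↦ ?_
    simp only [add_neg_cancel_right, heven]
    rw [abs_div, abs_sub_comm, ← abs_div]
  · simp only [hsub]
    exact hmove tendsto_const_nhds tendsto_const_nhds

end Interpolation

/-! ### The main theorem -/

theorem theorem2p2 {Ω : Type*} [MeasurableSpace Ω] (P : Measure Ω) [IsProbabilityMeasure P]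
    (G : ℝ → Ω → ℝ) (hGauss : IsGaussianProcess G P)
    (hmean : ∀ x, ∫ ω, G x ω ∂P = 0)
    (hstat : HasStationaryIncrements G P)
    (hcont : ∀ᵐ ω ∂P, Continuous fun x ↦ G x ω)
    (δ : ℝ) (hδ : 0 < δ)
    (hconc : ConcaveOn ℝ (Icc 0 δ) (incrementVar G P))
    (hmono : MonotoneOn (incrementVar G P) (Icc 0 δ))
    (hne : ∃ h ∈ Icc 0 δ, incrementVar G P h ≠ 0)
    (p q : ℝ) (hp : 1 ≤ p) (hpq : p < q)
    (hn : ℕ → ℝ) (hhn : ∀ n : ℕ, 2 ≤ n → hn n = 1 / (Real.log n) ^ q)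
    (hreg : Tendsto (fun n : ℕ ↦
      incrementStd G P (hn n - hn (n + 1)) / incrementStd G P (hn (n + 1))) atTop (𝓝 0)) :
    ∀ᵐ ω ∂P, ∀ a b : ℝ,
      Tendsto (fun h ↦ lpIncrement G P p a b h ω) (𝓝[≠] 0)
        (𝓝 ((∫ y, |y| ^ p ∂(gaussianReal 0 1)) * (b - a))) := by
  have hp0 : 0 < p := by linarith
  have hm0 : 0 ≤ ∫ y, |y| ^ p ∂(gaussianReal 0 1) := integral_nonneg fun y ↦ by positivity
  have hvpos : ∀ u, 0 < u → u ≤ δ → 0 < incrementVar G P u := fun u h1 h2 ↦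
    hconc.pos_of_ne_zero hmono incrementVar_zero hne h1 h2
  have hvnn : ∀ u, 0 ≤ incrementVar G P u := fun u ↦ integral_nonneg fun ω ↦ sq_nonneg _
  have hσpos : ∀ u, 0 < u → u ≤ δ → 0 < incrementStd G P u := fun u h1 h2 ↦
    Real.sqrt_pos.2 (hvpos u h1 h2)
  have hσm : MonotoneOn (incrementStd G P) (Icc 0 δ) := fun u hu v hv huv ↦
    Real.sqrt_le_sqrt (hmono hu hv huv)
  have hσsub : ∀ s t, 0 ≤ s → 0 ≤ t → s + t ≤ δ →
      incrementStd G P (s + t) ^ 2 ≤ incrementStd G P s ^ 2 + incrementStd G P t ^ 2 := by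
    intro s t hs ht hst
    simp only [incrementStd, Real.sq_sqrt (hvnn _)]
    have h1 := hconc.increment_le incrementVar_zero (h := t) (s := s + t) ht (by linarith) hst
    rw [add_sub_cancel_right] at h1
    linarith
  have hpos : ∀ᶠ n in atTop, 0 < hn n := by
    filter_upwards [eventually_ge_atTop 2] with n h2 using one_div_log_rpow_pos hhn h2
  -- Countably many endpoint pairs share one exceptional null set; everything afterwards is
  -- deterministic.
  have hseq : ∀ᵐ ω ∂P, ∀ ab : ℚ × ℚ, ab.1 < ab.2 →
      Tendsto (fun n ↦ lpIncrement G P p ab.1 ab.2 (hn n) ω) atTop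
        (𝓝 ((∫ y, |y| ^ p ∂(gaussianReal 0 1)) * ((ab.2 : ℝ) - ab.1))) := by
    refine ae_all_iff.2 fun ab ↦ ?_
    by_cases hab : ab.1 < ab.2
    · filter_upwards [ae_tendsto_lpIncrement_seq hGauss hmean hstat hcont hδ hconc hmono hne hp hpq
        hhn (Rat.cast_lt.2 hab)] with ω hω _ using hω
    · exact ae_of_all _ fun ω h ↦ absurd h hab
  filter_upwards [hseq, hcont] with ω hω hωc
  have hscale : ∀ {a b : ℝ} (_ : a ≤ b) (u : ℝ), lpIncrement G P p a b u ω
      = (incrementNorm (fun x ↦ G x ω) p a b u / incrementStd G P u) ^ p := by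
    intro a b hab u
    have h1 : 0 ≤ ∫ x in a..b, |G (x + u) ω - G x ω| ^ p :=
      intervalIntegral.integral_nonneg hab fun _ _ ↦ by positivity
    have h2 : 0 ≤ incrementStd G P u := Real.sqrt_nonneg _
    rw [Real.div_rpow (incrementNorm_nonneg hab u) h2, incrementNorm, ← Real.rpow_mul h1,
      inv_mul_cancel₀ hp0.ne', Real.rpow_one, ← intervalIntegral.integral_div, lpIncrement]
    refine intervalIntegral.integral_congr fun x _ ↦ ?_
    simp only [abs_div, abs_of_nonneg h2]
    rw [Real.div_rpow (abs_nonneg _) h2]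
  have hroot : ∀ {a b : ℝ} (_ : a ≤ b) (u : ℝ), incrementNorm (fun x ↦ G x ω) p a b u /
      incrementStd G P u = lpIncrement G P p a b u ω ^ p⁻¹ := by
    intro a b hab u
    have h2 : 0 ≤ incrementStd G P u := Real.sqrt_nonneg _
    rw [hscale hab, ← Real.rpow_mul (div_nonneg (incrementNorm_nonneg hab u) h2),
      mul_inv_cancel₀ hp0.ne', Real.rpow_one]
  have hnorm : ∀ {a b : ℚ}, a < b → Tendsto (fun n ↦
      incrementNorm (fun x ↦ G x ω) p a b (hn n) / incrementStd G P (hn n)) atTop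
      (𝓝 (((∫ y, |y| ^ p ∂(gaussianReal 0 1)) * ((b : ℝ) - a)) ^ p⁻¹)) := by
    intro a b hab
    simp only [hroot (Rat.cast_le.2 hab.le : (a : ℝ) ≤ b)]
    exact (hω (a, b) hab).rpow_const (Or.inr (by positivity))
  refine tendsto_increment_integral_of_rat hωc hp0.le (fun u ↦ ?_) fun a b hab ↦ ?_
  · rw [incrementStd, incrementVar_neg hstat, incrementStd]
  · have hab' : (a : ℝ) ≤ b := Rat.cast_le.2 hab.le
    -- The enlarged interval has rational endpoints too; its limit serves only to bound the
    -- increments over shifted intervals.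
    have h1 := hnorm (a := a) (b := b + 1) (by linarith)
    push_cast at h1
    have h2 := (tendsto_incrementNorm_div hωc hp hδ hσm hσpos (fun u ↦ Real.sqrt_nonneg _) hσsub
      hpos (tendsto_one_div_log_rpow (by linarith) hhn) hreg hab' (hnorm hab) h1).rpow_const
      (p := p) (Or.inr hp0.le)
    rw [← Real.rpow_mul (mul_nonneg hm0 (sub_nonneg.2 hab')), inv_mul_cancel₀ hp0.ne',
      Real.rpow_one] at h2
    exact h2.congr fun u ↦ (hscale hab' u).symm
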